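/- For integers $k\ge 1$ and $N\ge 1$ let $U_{k,N}:\{0,1\}^{k\times N}\to\{0,1\}$ be the function with $U_{k,N}(x)=1$ if and only if $\sum_{j=1}^{N}2^{N-j}(x_{1,j}+\dots+x_{k,j})\ge 2^N$. A monotone majority circuit is a finite directed acyclic graph, possibly with parallel edges (called wires), with a single node without outgoing wires (the output); each node without incoming wires is labeled by $0$, $1$ or an input variable, and every other node is a gate $\mathsf{THR}_{t,m}$ for some integer $t$, where $m$ is its in-degree, which outputs $1$ if and only if at least $t$ of its $m$ incoming wires carry a $1$. The size of the circuit is its number of wires, and its depth is the length of a longest directed path ending in the output; a depth-$d$ circuit is one of depth at most $d$. A Boolean function $f$ on $\{0,1\}^m$ is a monotone weighted threshold function if there are integers $w_1,\dots,w_m\ge 0$ and $t$ such that $f(x)=1$ if and only if $\sum_i w_ix_i\ge t$. (i) Let $d\ge 2$, $n\ge 2^{60d}$ and $N\ge (2^{13}n)^d$ be integers. Then every depth-$d$ monotone majority circuit that computes $U_{d,N}$ has size at least $2^{n/2^{60d}}$. (ii) Consequently, for every integer $d\ge 2$ there is a constant $c=c(d)>0$ such that, for all sufficiently large $N$ (depending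 on $d$), every depth-$d$ monotone majority circuit that computes $U_{d,N}$ has size at least $2^{cN^{1/d}}$. (iii) Consequently, monotone weighted threshold gates cannot be simulated efficiently by constant-depth monotone majority circuits: for every integer $d\ge 2$ there is a constant $c=c(d)>0$ such that, for all sufficiently large $m$ (depending on $d$), there is a monotone weighted threshold function $f:\{0,1\}^m\to\{0,1\}$ for which every depth-$d$ monotone majority circuit computing $f$ has size at least $2^{cm^{1/d}}$. -/

import Mathlib

/-- Labels of the nodes of a monotone majority circuit with input variables indexed by `ι`:
an input node carries one of the constants `0`, `1` or a variable; every other node is a monotone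
unweighted threshold gate with some integer threshold `t` (its arity is its in-degree). -/
inductive NodeLabel (ι : Type) : Type where
  | zero : NodeLabel ι
  | one : NodeLabel ι
  | var (i : ι) : NodeLabel ι
  | thr (t : ℤ) : NodeLabel ι

/-- The labels allowed at input nodes. -/
def NodeLabel.IsInput {ι : Type} : NodeLabel ι → Prop
  | .zero => True
  | .one => True
  | .var _ => True
  | .thr _ => False

/-- A monotone majority circuit: a finite directed acyclic multigraph. `wires u v` is the number of
parallel wires from `u` to `v`. The nodes without incoming wires are exactly those labelled by
a constant or a variable, and there is exactly one node without outgoing wires, the output. -/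
structure MonotoneMajorityCircuit (ι : Type) where
  numNodes : ℕ
  wires : Fin numNodes → Fin numNodes → ℕ
  acyclic : ∀ v, ¬ Relation.TransGen (fun u w => 0 < wires u w) v v
  label : Fin numNodes → NodeLabel ι
  isInput_iff : ∀ v, (label v).IsInput ↔ ∀ u, wires u v = 0
  output : Fin numNodes
  eq_output_iff : ∀ v, v = output ↔ ∀ w, wires v w = 0

namespace MonotoneMajorityCircuit

variable {ι : Type} (C : MonotoneMajorityCircuit ι)

theorem wellFounded_wires : WellFounded (fun u v => 0 < C.wires u v) := by
  have : IsTrans (Fin C.numNodes) (Relation.TransGen (fun u w => 0 < C.wires u w)) :=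
    ⟨fun _ _ _ => Relation.TransGen.trans⟩
  have : Std.Irrefl (Relation.TransGen (fun u w => 0 < C.wires u w)) := ⟨C.acyclic⟩
  have h := Finite.wellFounded_of_trans_of_irrefl
    (Relation.TransGen (fun u w => 0 < C.wires u w))
  exact Subrelation.wf (r := Relation.TransGen (fun u w => 0 < C.wires u w))
    (fun h => Relation.TransGen.single h) h

/-- The Boolean value computed at each node on the input `x`. -/
def value (x : ι → Bool) : Fin C.numNodes → Bool :=
  C.wellFounded_wires.fix fun v ih =>
    match C.label v with
    | .zero => false
    | .one => true
    | .var i => x i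
    | .thr t => decide (t ≤ ∑ u, if h : 0 < C.wires u v
        then (C.wires u v : ℤ) * ((ih u h).toNat : ℤ) else 0)

/-- A gate with threshold `t` outputs `1` iff at least `t` of its input wires carry a `1`. -/
theorem value_eq (x : ι → Bool) (v : Fin C.numNodes) :
    C.value x v =
      match C.label v with
      | .zero => false
      | .one => true
      | .var i => x i
      | .thr t => decide (t ≤ ∑ u, (C.wires u v : ℤ) * ((C.value x u).toNat : ℤ)) := by
  rw [value, WellFounded.fix_eq]
  rcases C.label v with _ | _ | i | t
  · rfl
  · rfl
  · rfl
  · simp only [decide_eq_decide]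
    refine iff_of_eq (congrArg _ (Finset.sum_congr rfl fun u _ => ?_))
    by_cases h : 0 < C.wires u v
    · simp only [h, dite_true]
    · have h0 : C.wires u v = 0 := by omega
      simp [h0]

/-- The length of a longest directed path ending in a given node. -/
def depthAt : Fin C.numNodes → ℕ :=
  C.wellFounded_wires.fix fun v ih =>
    Finset.univ.sup fun u => if h : 0 < C.wires u v then ih u h + 1 else 0

theorem depthAt_eq (v : Fin C.numNodes) :
    C.depthAt v =
      Finset.univ.sup fun u => if 0 < C.wires u v then C.depthAt u + 1 else 0 := by
  rw [depthAt, WellFounded.fix_eq]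
  rfl

/-- The depth: the length of a longest directed path ending in the output node. -/
def depth : ℕ := C.depthAt C.output

/-- The size: the number of wires, that is, the sum of the in-degrees of the gates. -/
def size : ℕ := ∑ v, ∑ u, C.wires u v

/-- The output of the circuit on the input `x`. -/
def eval (x : ι → Bool) : Bool := C.value x C.output

/-- The circuit computes the Boolean function `f`. -/
def Computes (f : (ι → Bool) → Bool) : Prop := ∀ x, C.eval x = f x

end MonotoneMajorityCircuit

/-- The sum of the `k` numbers whose `N`-bit binary representations are the rows of `x`; the
`0`-based column index `j` has weight `2 ^ (N - (j + 1))`, so column `0` is most significant. -/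
def rowSum (k N : ℕ) (x : Fin k × Fin N → Bool) : ℕ :=
  ∑ j : Fin N, 2 ^ (N - (j.val + 1)) * ∑ i : Fin k, (x (i, j)).toNat

/-- The function `U_{k,N}`: it outputs `1` iff the `k` numbers add up to at least `2 ^ N`. -/
def U (k N : ℕ) (x : Fin k × Fin N → Bool) : Bool := decide (2 ^ N ≤ rowSum k N x)

/-- `f` is computed by a monotone weighted threshold gate, that is, one with non-negative integer
weights. -/
def IsMonotoneWeightedThreshold {m : ℕ} (f : (Fin m → Bool) → Bool) : Prop :=
  ∃ (w : Fin m → ℤ) (t : ℤ), (∀ i, 0 ≤ w i) ∧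
    ∀ x, f x = true ↔ t ≤ ∑ i, w i * ((x i).toNat : ℤ)

/-! The proof is by induction on the depth `d`, constructing random inputs `P` with sum `2 ^ N` and
`Q` with sum `2 ^ N - d` that no depth-`d` formula of bounded fan-in separates (`HasHardPair`). Only
the fan-in is bounded, so unfolding a circuit into a formula costs nothing.

To go from `d` to `d + 1`, a new row and extra columns turn a hard pair into a gadget with two
fooling pairs: `P₁`, `Q₁` with sums `2 ^ N`, `2 ^ N - 1`, and `P₂`, `Q₂` with sums `2 ^ N - 1`, `2 ^
N - (d + 1)`. Concatenate `M` blocks. Before a random position `a` every block is an independent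
fair mixture of `Q₁` and `P₂`, so it has sum `2 ^ N - 1` and propagates a carry. Then either `P₁`
followed by zeros produces the carry, or `Q₂` followed by ones misses it.

Consider the at most `W` subformulas below the top gate. Each revealed block decides some of them,
in the sense that the remaining blocks no longer matter. A harmonic-number potential
(`uniform_walk_drop_le`) shows that at most positions the next random block decides only a small
fraction of those still undecided. At such a position, `Q₁` followed by zeros rarely makes an
undecided subformula true, hence neither does `P₁`; dually, `Q₂` followed by ones rarely makes one
false. So nearly all undecided subformulas are 0 in the first case and 1 in the second. By Markov's
inequality the top gate, according to its threshold, is nearly always 0 on the input with sum `2 ^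
N` or nearly always 1 on the smaller one (`threshold_dichotomy`), so it is fooled. This is
`HasGadget.hardPair`; each level costs a factor 16 in the error and a factor of at most `2 * M` in
the length. The base case is `hasGadget_one`. -/

/-! ### Finitely additive expectations and random sequences. -/

/-- A finitely additive expectation: a monotone normalized linear functional on real functions. -/
structure Expectation (α : Type) where
  toLin : (α → ℝ) →ₗ[ℝ] ℝ
  mono' : ∀ f g : α → ℝ, f ≤ g → toLin f ≤ toLin g
  one' : toLin (fun _ => 1) = 1

namespace Expectation

variable {α β : Type}

instance : CoeFun (Expectation α) (fun _ => (α → ℝ) → ℝ) := ⟨fun μ => μ.toLin⟩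

theorem mono (μ : Expectation α) {f g : α → ℝ} (h : ∀ a, f a ≤ g a) : μ f ≤ μ g :=
  μ.mono' f g h

theorem add (μ : Expectation α) (f g : α → ℝ) : μ (fun a => f a + g a) = μ f + μ g :=
  map_add μ.toLin f g

theorem sub (μ : Expectation α) (f g : α → ℝ) : μ (fun a => f a - g a) = μ f - μ g :=
  map_sub μ.toLin f g

theorem const_mul (μ : Expectation α) (c : ℝ) (f : α → ℝ) : μ (fun a => c * f a) = c * μ f :=
  map_smul μ.toLin c f

theorem const (μ : Expectation α) (c : ℝ) : μ (fun _ => c) = c := by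
  have h := μ.const_mul c (fun _ => 1)
  have h1 : μ (fun _ => (1 : ℝ)) = 1 := μ.one'
  simpa [h1] using h

theorem sum (μ : Expectation α) {κ : Type} (s : Finset κ) (f : κ → α → ℝ) :
    μ (fun a => ∑ i ∈ s, f i a) = ∑ i ∈ s, μ (f i) := by
  have h := map_sum μ.toLin f s
  rw [← h]
  congr 1
  ext a
  simp

theorem nonneg (μ : Expectation α) {f : α → ℝ} (h : ∀ a, 0 ≤ f a) : 0 ≤ μ f := by
  have := μ.mono (f := fun _ => 0) (g := f) h
  rwa [μ.const] at this

theorem le_const (μ : Expectation α) {f : α → ℝ} {c : ℝ} (h : ∀ a, f a ≤ c) : μ f ≤ c := by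
  have := μ.mono (f := f) (g := fun _ => c) h
  rwa [μ.const] at this

/-- The Dirac expectation at a point. -/
def dirac (a : α) : Expectation α where
  toLin := LinearMap.proj a
  mono' _ _ h := h a
  one' := rfl

/-- Sampling in two stages. -/
def bind (μ : Expectation α) (κ : α → Expectation β) : Expectation β where
  toLin :=
    { toFun := fun f => μ fun a => κ a f
      map_add' := fun f g => by
        rw [← μ.add]
        congr 1
        ext a
        exact (κ a).add f g
      map_smul' := fun c f => by
        simp only [RingHom.id_apply, smul_eq_mul]
        rw [← μ.const_mul]
        congr 1
        ext a
        exact (κ a).const_mul c f }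
  mono' f g h := μ.mono fun a => (κ a).mono h
  one' := by
    have h : ∀ a, κ a (fun _ => (1 : ℝ)) = 1 := fun a => (κ a).one'
    change μ (fun a => κ a fun _ => 1) = 1
    simp only [h]
    exact μ.one'

theorem bind_apply (μ : Expectation α) (κ : α → Expectation β) (f : β → ℝ) :
    μ.bind κ f = μ fun a => κ a f := rfl

/-- The push-forward. -/
def map (φ : α → β) (μ : Expectation α) : Expectation β := μ.bind fun a => dirac (φ a)

theorem map_apply (φ : α → β) (μ : Expectation α) (f : β → ℝ) :
    μ.map φ f = μ fun a => f (φ a) := rfl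

/-- The uniform average over `Fin n`. -/
noncomputable def uniform (n : ℕ) [NeZero n] : Expectation (Fin n) where
  toLin :=
    { toFun := fun f => (∑ i, f i) / n
      map_add' := fun f g => by simp [Finset.sum_add_distrib, add_div]
      map_smul' := fun c f => by
        simp [← Finset.mul_sum, mul_div_assoc] }
  mono' f g h := by
    change (∑ i, f i) / (n : ℝ) ≤ (∑ i, g i) / n
    gcongr with i
    exact h i
  one' := by
    change (∑ _i : Fin n, (1 : ℝ)) / (n : ℝ) = 1
    simp

theorem uniform_apply (n : ℕ) [NeZero n] (f : Fin n → ℝ) :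
    uniform n f = (∑ i, f i) / n := rfl

/-- A fair coin. -/
noncomputable def coin (x y : α) : Expectation α where
  toLin :=
    { toFun := fun f => (f x + f y) / 2
      map_add' := fun f g => by simp; ring
      map_smul' := fun c f => by simp; ring }
  mono' f g h := by
    change (f x + f y) / 2 ≤ (g x + g y) / 2
    linarith [h x, h y]
  one' := by
    change ((1 : ℝ) + 1) / 2 = 1
    norm_num

theorem nonempty (μ : Expectation α) : Nonempty α := by
  by_contra h
  rw [not_nonempty_iff] at h
  have h1 := μ.const 1
  have h0 := μ.const 0
  have : (fun _ : α => (1 : ℝ)) = fun _ => 0 := Subsingleton.elim _ _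
  rw [this, h0] at h1
  norm_num at h1

/-- The random sequence whose first `n` entries are independent samples of `μ`; the other entries
are irrelevant. -/
noncomputable def walk (μ : Expectation α) (l₀ : ℕ → α) : ℕ → Expectation (ℕ → α)
  | 0 => dirac l₀
  | n + 1 => (walk μ l₀ n).bind fun l => μ.map fun a => Function.update l n a

theorem walk_succ (μ : Expectation α) (l₀ : ℕ → α) (n : ℕ) (f : (ℕ → α) → ℝ) :
    μ.walk l₀ (n + 1) f = μ.walk l₀ n fun l => μ fun a => f (Function.update l n a) := rfl

end Expectation

/-! ### Threshold formulas, and circuits unfolded into formulas. -/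

/-- Functions computed by formulas of depth `d` made of unweighted threshold gates of fan-in at
most `W`, over constants and variables. -/
def IsThr (W : ℕ) {ι : Type} : ℕ → ((ι → Bool) → Bool) → Prop
  | 0, g => (∃ c, g = fun _ => c) ∨ ∃ i, g = fun x => x i
  | d + 1, g => IsThr W d g ∨ ∃ (κ : Type) (_ : Fintype κ) (t : ℤ) (f : κ → (ι → Bool) → Bool),
      Fintype.card κ ≤ W ∧ (∀ i, IsThr W d (f i)) ∧
        g = fun x => decide (t ≤ ∑ i, ((f i x).toNat : ℤ))

/-- Substitutions of constants and variables for variables. -/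
def IsSubst {ι κ : Type} (σ : (κ → Bool) → ι → Bool) : Prop :=
  ∀ j, (∃ c, ∀ x, σ x j = c) ∨ ∃ i, ∀ x, σ x j = x i

namespace IsThr

variable {ι κ : Type} {W d : ℕ}

theorem const (W d : ℕ) (c : Bool) : IsThr W d (fun _ : ι → Bool => c) := by
  induction d with
  | zero => exact Or.inl ⟨c, rfl⟩
  | succ d ih => exact Or.inl ih

theorem var (W d : ℕ) (i : ι) : IsThr W d (fun x : ι → Bool => x i) := by
  induction d with
  | zero => exact Or.inr ⟨i, rfl⟩
  | succ d ih => exact Or.inl ih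

theorem mono_depth {d' : ℕ} (h : d ≤ d') {g : (ι → Bool) → Bool} (hg : IsThr W d g) :
    IsThr W d' g := by
  induction h with
  | refl => exact hg
  | step _ ih => exact Or.inl ih

theorem mono_fanIn {W' : ℕ} (h : W ≤ W') {g : (ι → Bool) → Bool} (hg : IsThr W d g) :
    IsThr W' d g := by
  induction d generalizing g with
  | zero => exact hg
  | succ d ih =>
    rcases hg with hg | ⟨κ, hκ, t, f, hs, hf, rfl⟩
    · exact Or.inl (ih hg)
    · exact Or.inr ⟨κ, hκ, t, f, hs.trans h, fun i => ih (hf i), rfl⟩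

theorem monotone {g : (ι → Bool) → Bool} (hg : IsThr W d g) : Monotone g := by
  induction d generalizing g with
  | zero =>
    rcases hg with ⟨c, rfl⟩ | ⟨i, rfl⟩
    · exact monotone_const
    · exact fun x y h => h i
  | succ d ih =>
    rcases hg with hg | ⟨κ, hκ, t, f, hs, hf, rfl⟩
    · exact ih hg
    · intro x y h
      have hle : ∑ i, ((f i x).toNat : ℤ) ≤ ∑ i, ((f i y).toNat : ℤ) := by
        refine Finset.sum_le_sum fun i _ => ?_
        exact_mod_cast Bool.toNat_le_toNat (ih (hf i) h)
      rw [Bool.le_iff_imp]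
      simp only [decide_eq_true_eq]
      exact fun h' => h'.trans hle

theorem comp_subst {g : (ι → Bool) → Bool} (hg : IsThr W d g) {σ : (κ → Bool) → ι → Bool}
    (hσ : IsSubst σ) : IsThr W d (fun x => g (σ x)) := by
  induction d generalizing g with
  | zero =>
    rcases hg with ⟨c, rfl⟩ | ⟨i, rfl⟩
    · exact const W 0 c
    · rcases hσ i with ⟨c, hc⟩ | ⟨j, hj⟩
      · simp only [hc]
        exact const W 0 c
      · simp only [hj]
        exact var W 0 j
  | succ d ih =>
    rcases hg with hg | ⟨κ, hκ, t, f, hs, hf, rfl⟩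
    · exact Or.inl (ih hg)
    · exact Or.inr ⟨κ, hκ, t, fun i x => f i (σ x), hs, fun i => ih (hf i), rfl⟩

end IsThr

namespace MonotoneMajorityCircuit

variable {ι : Type} (C : MonotoneMajorityCircuit ι)

/-- Sharing of gates is irrelevant here: `IsThr` bounds each fan-in but not the number of gates of
the formula, and every in-degree is at most the number of wires. -/
theorem isThr_value (v : Fin C.numNodes) :
    IsThr C.size (C.depthAt v) (fun x => C.value x v) := by
  induction v using C.wellFounded_wires.induction with
  | _ v ih =>
  have hv := fun x => C.value_eq x v
  simp only [hv]
  rcases hl : C.label v with _ | _ | i | t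
  · exact IsThr.const _ _ _
  · exact IsThr.const _ _ _
  · exact IsThr.var _ _ _
  · simp only
    have hdep : ∀ u, 0 < C.wires u v → C.depthAt u + 1 ≤ C.depthAt v := by
      intro u hu
      rw [C.depthAt_eq v]
      refine le_trans ?_ (Finset.le_sup (Finset.mem_univ u))
      rw [if_pos hu]
    have hpos : ∃ u, 0 < C.wires u v := by
      by_contra h
      push Not at h
      have h1 := (C.isInput_iff v).2 fun u => Nat.le_zero.1 (h u)
      rw [hl] at h1
      exact h1
    obtain ⟨u₀, hu₀⟩ := hpos
    obtain ⟨d, hd⟩ : ∃ d, C.depthAt v = d + 1 :=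
      ⟨C.depthAt v - 1, by have := hdep u₀ hu₀; omega⟩
    rw [hd]
    -- Parallel wires become distinct children.
    refine Or.inr ⟨(u : Fin C.numNodes) × Fin (C.wires u v), inferInstance, t,
      fun p x => C.value x p.1, ?_, ?_, ?_⟩
    · rw [Fintype.card_sigma]
      simp only [Fintype.card_fin]
      exact Finset.single_le_sum (f := fun v => ∑ u, C.wires u v) (fun _ _ => Nat.zero_le _)
        (Finset.mem_univ v)
    · rintro ⟨u, j⟩
      have hu : 0 < C.wires u v := j.pos
      exact (ih u hu).mono_depth (by have := hdep u hu; omega)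
    · ext x
      rw [Fintype.sum_sigma]
      simp

theorem isThr_eval {d : ℕ} (h : C.depth ≤ d) : IsThr C.size d C.eval :=
  (C.isThr_value C.output).mono_depth h

end MonotoneMajorityCircuit

/-! ### Fooling pairs and gadgets. -/

/-- Given the public sample `ρ`, no formula of depth `d` and fan-in at most `W` is likely on `P` and
unlikely on `Q`, except with probability `ε` over `ρ`. -/
def Fools {R I ι : Type} (μ : Expectation R) (κ : R → Expectation I) (W d : ℕ) (ε : ℝ)
    (P Q : I → ι → Bool) : Prop :=
  ∀ g : (ι → Bool) → Bool, IsThr W d g →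
    μ (fun ρ => if ε < κ ρ (fun i => ((g (P i)).toNat : ℝ)) ∧
      κ ρ (fun i => ((g (Q i)).toNat : ℝ)) < 1 - ε then 1 else 0) ≤ ε

theorem toNat_real_le {a b : Bool} (h : a ≤ b) : (a.toNat : ℝ) ≤ (b.toNat : ℝ) := by
  exact_mod_cast Bool.toNat_le_toNat h

/-- Substitutions preserve depth and fan-in. Since formulas are monotone, lowering `P` or raising
`Q` only makes fooling easier. -/
theorem Fools.of_subst {R I ι ι' : Type} {μ : Expectation R} {κ : R → Expectation I} {W d : ℕ}
    {ε : ℝ} {P Q : I → ι → Bool} (h : Fools μ κ W d ε P Q) {σ : (ι → Bool) → ι' → Bool}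
    (hσ : IsSubst σ) {P' Q' : I → ι' → Bool} (hP : ∀ i, P' i ≤ σ (P i))
    (hQ : ∀ i, σ (Q i) ≤ Q' i) : Fools μ κ W d ε P' Q' := by
  intro g hg
  refine le_trans (μ.mono fun ρ => ?_) (h _ (hg.comp_subst hσ))
  have h1 : κ ρ (fun i => ((g (P' i)).toNat : ℝ)) ≤
      κ ρ (fun i => ((g (σ (P i))).toNat : ℝ)) :=
    (κ ρ).mono fun i => toNat_real_le (hg.monotone (hP i))
  have h2 : κ ρ (fun i => ((g (σ (Q i))).toNat : ℝ)) ≤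
      κ ρ (fun i => ((g (Q' i)).toNat : ℝ)) :=
    (κ ρ).mono fun i => toNat_real_le (hg.monotone (hQ i))
  split_ifs with ha hb hb
  · exact le_rfl
  · exact absurd ⟨ha.1.trans_le h1, h2.trans_lt ha.2⟩ hb
  · exact zero_le_one
  · exact le_rfl

/-- Inputs with `d` rows summing to `2 ^ N` that formulas of depth `d` cannot tell from inputs
summing to `2 ^ N - d`. -/
def HasHardPair (W : ℕ) (ε : ℝ) (d N : ℕ) : Prop :=
  ∃ (R I : Type) (μ : Expectation R) (κ : R → Expectation I) (P Q : I → Fin d × Fin N → Bool),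
    (∀ i, rowSum d N (P i) = 2 ^ N) ∧ (∀ i, rowSum d N (Q i) + d = 2 ^ N) ∧ Fools μ κ W d ε P Q

/-- Two pairs of inputs with `d + 1` rows that formulas of depth `d` cannot tell apart. The inputs
`Q₁` (for `D = 1`) and `P₂` sum to `2 ^ N - 1`, that is, they propagate a carry. -/
def HasGadget (W : ℕ) (ε : ℝ) (d N D : ℕ) : Prop :=
  ∃ (R I : Type) (μ : Expectation R) (κ : R → Expectation I)
    (P₁ Q₁ P₂ Q₂ : I → Fin (d + 1) × Fin N → Bool),
    (∀ i, rowSum (d + 1) N (P₁ i) = 2 ^ N) ∧ (∀ i, rowSum (d + 1) N (Q₁ i) + D = 2 ^ N) ∧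
    (∀ i, rowSum (d + 1) N (P₂ i) + 1 = 2 ^ N) ∧
    (∀ i, rowSum (d + 1) N (Q₂ i) + (d + 1) = 2 ^ N) ∧
    Fools μ κ W d ε P₁ Q₁ ∧ Fools μ κ W d ε P₂ Q₂

theorem sum_two_pow_rev (N : ℕ) : ∑ j : Fin N, 2 ^ (N - (j.val + 1)) + 1 = 2 ^ N := by
  induction N with
  | zero => simp
  | succ N ih =>
    rw [Fin.sum_univ_succ]
    simp only [Fin.val_zero, Fin.val_succ]
    have : ∀ j : Fin N, N + 1 - (j.val + 1 + 1) = N - (j.val + 1) := fun j => by omega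
    simp only [this]
    rw [pow_succ, show N + 1 - (0 + 1) = N by omega]
    omega

/-! ### From a hard pair to a gadget: extra columns and an extra row. -/

/-- Append a least significant column. -/
def appendColumn {k N : ℕ} (u : Fin k → Bool) (x : Fin k × Fin N → Bool) :
    Fin k × Fin (N + 1) → Bool :=
  fun p => Fin.lastCases (motive := fun _ => Bool) (u p.1) (fun j => x (p.1, j)) p.2

theorem isSubst_appendColumn {k N : ℕ} (u : Fin k → Bool) :
    IsSubst (appendColumn (N := N) u) := by
  rintro ⟨r, c⟩
  induction c using Fin.lastCases with
  | last => exact Or.inl ⟨u r, fun x => by simp [appendColumn]⟩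
  | cast j => exact Or.inr ⟨(r, j), fun x => by simp [appendColumn]⟩

theorem appendColumn_mono {k N : ℕ} {u v : Fin k → Bool} (h : u ≤ v)
    (x : Fin k × Fin N → Bool) : appendColumn u x ≤ appendColumn v x := by
  rintro ⟨r, c⟩
  induction c using Fin.lastCases with
  | last => simpa [appendColumn] using h r
  | cast j => simp [appendColumn]

theorem rowSum_appendColumn {k N : ℕ} (u : Fin k → Bool) (x : Fin k × Fin N → Bool) :
    rowSum k (N + 1) (appendColumn u x) = 2 * rowSum k N x + ∑ i, (u i).toNat := by
  unfold rowSum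
  rw [Fin.sum_univ_castSucc, Finset.mul_sum _ _ 2]
  refine congrArg₂ _ (Finset.sum_congr rfl fun j _ => ?_) (by simp [appendColumn])
  simp only [appendColumn, Fin.lastCases_castSucc, Fin.val_castSucc]
  rw [show N + 1 - (j.val + 1) = N - (j.val + 1) + 1 by omega, pow_succ]
  ring

theorem sum_toNat_decide_lt {k c : ℕ} (h : c ≤ k) :
    ∑ i : Fin k, (decide (i.val < c)).toNat = c := by
  have : ∀ i : Fin k, (decide (i.val < c)).toNat = if i.val < c then 1 else 0 := fun i => by
    by_cases hi : i.val < c <;> simp [hi]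
  simp only [this]
  rw [Fin.sum_univ_eq_sum_range (fun i => if i < c then 1 else 0) k, Finset.sum_ite]
  simp only [Finset.sum_const, smul_eq_mul, mul_one, mul_zero, add_zero]
  have : (Finset.range k).filter (· < c) = Finset.range c := by
    ext i
    simp only [Finset.mem_filter, Finset.mem_range]
    omega
  rw [this, Finset.card_range]

/-- A new last column doubles every deficit and subtracts its number of ones. With 0, `D + 2`, 1 and
`d + 1` ones the deficits 0, `D + 1`, 1, `d + 1` become 0, `D`, 1, `d + 1`. The bound on `D` makes
room for `D + 2` ones in `d + 1` rows. -/
theorem HasGadget.append {W d N D : ℕ} {ε : ℝ} (h : HasGadget W ε d N (D + 1)) (hD : D + 1 ≤ d) :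
    HasGadget W ε d (N + 1) D := by
  obtain ⟨R, I, μ, κ, P₁, Q₁, P₂, Q₂, hP₁, hQ₁, hP₂, hQ₂, h₁, h₂⟩ := h
  refine ⟨R, I, μ, κ, fun i => appendColumn (fun _ => false) (P₁ i),
    fun i => appendColumn (fun r => decide (r.val < D + 2)) (Q₁ i),
    fun i => appendColumn (fun r => decide (r.val < 1)) (P₂ i),
    fun i => appendColumn (fun _ => true) (Q₂ i), fun i => ?_, fun i => ?_, fun i => ?_,
    fun i => ?_, ?_, ?_⟩
  · rw [rowSum_appendColumn, hP₁, pow_succ]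
    simp [mul_comm]
  · rw [rowSum_appendColumn, sum_toNat_decide_lt (by omega), pow_succ, ← hQ₁ i]
    ring
  · rw [rowSum_appendColumn, sum_toNat_decide_lt (by omega), pow_succ, ← hP₂ i]
    ring
  · rw [rowSum_appendColumn, pow_succ, ← hQ₂ i]
    simp only [Bool.toNat_true, Finset.sum_const, Finset.card_univ, Fintype.card_fin, smul_eq_mul]
    ring
  · exact h₁.of_subst (isSubst_appendColumn fun _ => false) (fun i => le_rfl)
      fun i => appendColumn_mono (fun _ => Bool.false_le _) _
  · exact h₂.of_subst (isSubst_appendColumn fun r => decide (r.val < 1)) (fun i => le_rfl)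
      fun i => appendColumn_mono (fun _ => Bool.le_true _) _

theorem HasGadget.append_iterate {W d N D : ℕ} {ε : ℝ} (h : HasGadget W ε d N (D + 1))
    (hD : D + 1 ≤ d) : HasGadget W ε d (N + D) 1 := by
  induction D generalizing N with
  | zero => exact h
  | succ D ih =>
    have := ih (h.append hD) (by omega)
    rwa [show N + (D + 1) = N + 1 + D by omega]

/-- Prepend a most significant column and a new first row; the new row has the leading entry `z₀`
and all other entries `z`, the rest of the new column is zero. -/
def addRowColumn {k N : ℕ} (z₀ z : Bool) (x : Fin k × Fin N → Bool) :
    Fin (k + 1) × Fin (N + 1) → Bool :=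
  fun p => Fin.cases (motive := fun _ => Bool)
    (Fin.cases (motive := fun _ => Bool) z₀ (fun _ => z) p.2)
    (fun r => Fin.cases (motive := fun _ => Bool) false (fun c => x (r, c)) p.2) p.1

theorem isSubst_addRowColumn {k N : ℕ} (z₀ z : Bool) :
    IsSubst (addRowColumn (k := k) (N := N) z₀ z) := by
  rintro ⟨r, c⟩
  induction r using Fin.cases with
  | zero => exact Or.inl ⟨_, fun x => rfl⟩
  | succ r =>
    induction c using Fin.cases with
    | zero => exact Or.inl ⟨false, fun x => rfl⟩
    | succ c => exact Or.inr ⟨(r, c), fun x => rfl⟩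

theorem rowSum_addRowColumn {k N : ℕ} (z₀ z : Bool) (x : Fin k × Fin N → Bool) :
    rowSum (k + 1) (N + 1) (addRowColumn z₀ z x) =
      2 ^ N * z₀.toNat + (2 ^ N - 1) * z.toNat + rowSum k N x := by
  have h1 : ∑ j : Fin N, 2 ^ (N - (j.val + 1)) = 2 ^ N - 1 := by
    have := sum_two_pow_rev N
    omega
  unfold rowSum
  rw [Fin.sum_univ_succ, add_assoc, ← h1, Finset.sum_mul, ← Finset.sum_add_distrib]
  congr 1
  · rw [Fin.sum_univ_succ]
    simp [addRowColumn]
  · refine Finset.sum_congr rfl fun j _ => ?_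
    rw [Fin.sum_univ_succ]
    simp only [addRowColumn, Fin.cases_zero, Fin.cases_succ, Fin.val_succ]
    rw [show N + 1 - (j.val + 1 + 1) = N - (j.val + 1) by omega]
    ring

/-- The new row contributes `2 ^ N` (only its leading bit set) for the first pair and `2 ^ N - 1`
(all other bits set) for the second, which gives deficits 0, `d` and 1, `d + 1` from `2 ^ (N + 1)`.
-/
theorem HasHardPair.gadget {W d N : ℕ} {ε : ℝ} (h : HasHardPair W ε d N) :
    HasGadget W ε d (N + 1) d := by
  obtain ⟨R, I, μ, κ, P, Q, hP, hQ, hF⟩ := h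
  have hpos : 0 < 2 ^ N := by positivity
  refine ⟨R, I, μ, κ, fun i => addRowColumn true false (P i),
    fun i => addRowColumn true false (Q i), fun i => addRowColumn false true (P i),
    fun i => addRowColumn false true (Q i), fun i => ?_, fun i => ?_, fun i => ?_, fun i => ?_,
    hF.of_subst (isSubst_addRowColumn _ _) (fun _ => le_rfl) fun _ => le_rfl,
    hF.of_subst (isSubst_addRowColumn _ _) (fun _ => le_rfl) fun _ => le_rfl⟩
  all_goals
    have h1 := hP i
    have h2 := hQ i
    rw [rowSum_addRowColumn, pow_succ]
    simp only [Bool.toNat_true, Bool.toNat_false]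
    omega

/-! ### Carries between blocks of columns. -/

/-- `∑ q ^ (n - 1 - b) v_b`, the value of a number with the base `q` digits `v`. -/
def hornerSum (q : ℕ) (v : ℕ → ℕ) (n : ℕ) : ℕ := ∑ b ∈ Finset.range n, q ^ (n - 1 - b) * v b

theorem hornerSum_zero (q : ℕ) (v : ℕ → ℕ) : hornerSum q v 0 = 0 := by simp [hornerSum]

theorem hornerSum_succ (q : ℕ) (v : ℕ → ℕ) (n : ℕ) :
    hornerSum q v (n + 1) = q * hornerSum q v n + v n := by
  unfold hornerSum
  rw [Finset.sum_range_succ, Finset.mul_sum]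
  congr 1
  · refine Finset.sum_congr rfl fun b hb => ?_
    rw [Finset.mem_range] at hb
    rw [show n + 1 - 1 - b = n - 1 - b + 1 by omega, pow_succ]
    ring
  · simp

theorem hornerSum_carry {q : ℕ} {v : ℕ → ℕ} {a : ℕ} (hv : ∀ b < a, v b + 1 = q) :
    hornerSum q v a + 1 = q ^ a := by
  induction a with
  | zero => simp [hornerSum_zero]
  | succ a ih =>
    rw [hornerSum_succ, pow_succ, ← ih fun b hb => hv b (by omega), add_assoc, hv a (by omega)]
    ring

/-- The digit `q` at position `a` creates a carry that ripples through all the preceding digits `q -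
1`. -/
theorem hornerSum_eq_pow {q : ℕ} {v : ℕ → ℕ} {a n : ℕ} (hv : ∀ b < a, v b + 1 = q)
    (ha : v a = q) (hv' : ∀ b, a < b → v b = 0) (han : a < n) : hornerSum q v n = q ^ n := by
  induction n, han using Nat.le_induction with
  | base =>
    rw [hornerSum_succ, ha, pow_succ, ← hornerSum_carry hv]
    ring
  | succ n hn ih =>
    rw [hornerSum_succ, ih, hv' n hn, pow_succ]
    ring

/-- The deficit `k` is stable: a further digit `k * (q - 1)` turns `q ^ m - k` into `q * (q ^ m - k)
+ k * (q - 1) = q ^ (m + 1) - k`. -/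
theorem hornerSum_add_eq_pow {q k : ℕ} {v : ℕ → ℕ} {a n : ℕ} (hv : ∀ b < a, v b + 1 = q)
    (ha : v a + k = q) (hv' : ∀ b, a < b → v b + k = k * q) (han : a < n) :
    hornerSum q v n + k = q ^ n := by
  induction n, han using Nat.le_induction with
  | base =>
    rw [hornerSum_succ, add_assoc, ha, pow_succ, ← hornerSum_carry hv]
    ring
  | succ n hn ih =>
    rw [hornerSum_succ, add_assoc, hv' n hn, pow_succ, ← ih]
    ring

/-- The input made of `M` blocks of columns: the first `n` blocks are `l`, the other blocks are
filled with the constant `z`. -/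
def assemble {k N : ℕ} (M n : ℕ) (l : ℕ → Fin k × Fin N → Bool) (z : Bool) :
    Fin k × Fin (M * N) → Bool :=
  fun p => if p.2.divNat.val < n then l p.2.divNat.val (p.1, p.2.modNat) else z

theorem assemble_mono {k N M n : ℕ} {l l' : ℕ → Fin k × Fin N → Bool} {z z' : Bool}
    (hl : ∀ b < n, l b ≤ l' b) (hz : z ≤ z') : assemble M n l z ≤ assemble M n l' z' := by
  intro p
  unfold assemble
  split_ifs with h
  · exact hl _ h _
  · exact hz

theorem assemble_congr {k N M n : ℕ} {l l' : ℕ → Fin k × Fin N → Bool} {z : Bool}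
    (hl : ∀ b < n, l b = l' b) : assemble M n l z = assemble M n l' z :=
  le_antisymm (assemble_mono (fun b hb => (hl b hb).le) le_rfl)
    (assemble_mono (fun b hb => (hl b hb).ge) le_rfl)

theorem assemble_false_le {k N M n n' : ℕ} (h : n ≤ n') (l : ℕ → Fin k × Fin N → Bool) (z : Bool) :
    assemble M n l false ≤ assemble M n' l z := by
  intro p
  unfold assemble
  split_ifs with h1 h2
  · exact le_rfl
  · exact absurd (h1.trans_le h) h2
  · exact Bool.false_le _
  · exact Bool.false_le _

theorem le_assemble_true {k N M n n' : ℕ} (h : n ≤ n') (l : ℕ → Fin k × Fin N → Bool) (z : Bool) :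
    assemble M n' l z ≤ assemble M n l true := by
  intro p
  unfold assemble
  split_ifs with h1 h2
  · exact le_rfl
  · exact Bool.le_true _
  · exact absurd (lt_of_lt_of_le ‹_› h) h1
  · exact Bool.le_true _

theorem isSubst_assemble_update {k N : ℕ} (M n : ℕ) (l : ℕ → Fin k × Fin N → Bool) (z : Bool) :
    IsSubst fun x => assemble M (n + 1) (Function.update l n x) z := by
  intro p
  by_cases h : p.2.divNat.val < n + 1
  · by_cases h' : p.2.divNat.val = n
    · refine Or.inr ⟨(p.1, p.2.modNat), fun x => ?_⟩
      exact (if_pos h).trans (by rw [h', Function.update_self])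
    · refine Or.inl ⟨l p.2.divNat.val (p.1, p.2.modNat), fun x => ?_⟩
      exact (if_pos h).trans (by rw [Function.update_of_ne h'])
  · exact Or.inl ⟨z, fun x => if_neg h⟩

theorem rowSum_assemble {k N : ℕ} (M n : ℕ) (l : ℕ → Fin k × Fin N → Bool) (z : Bool) :
    rowSum k (M * N) (assemble M n l z) =
      hornerSum (2 ^ N) (fun b => if b < n then rowSum k N (l b) else rowSum k N fun _ => z) M := by
  unfold hornerSum rowSum
  rw [Finset.sum_range, ← finProdFinEquiv.sum_comp, Fintype.sum_prod_type]
  refine Finset.sum_congr rfl fun b _ => ?_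
  have hd : ∀ j : Fin N, (finProdFinEquiv (b, j)).divNat = b := fun j =>
    congrArg Prod.fst (finProdFinEquiv.symm_apply_apply (b, j))
  have hm : ∀ j : Fin N, (finProdFinEquiv (b, j)).modNat = j := fun j =>
    congrArg Prod.snd (finProdFinEquiv.symm_apply_apply (b, j))
  have hexp : ∀ j : Fin N, 2 ^ (M * N - ((finProdFinEquiv (b, j)).val + 1)) =
      (2 ^ N) ^ (M - 1 - b.val) * 2 ^ (N - (j.val + 1)) := by
    intro j
    rw [← pow_mul, ← pow_add]
    congr 1
    have hb := b.isLt
    have hj := j.isLt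
    have h3 : M * N = N * b.val + N + N * (M - 1 - b.val) := by
      conv_lhs => rw [show M = b.val + 1 + (M - 1 - b.val) by omega]
      ring
    simp only [finProdFinEquiv_apply_val]
    omega
  simp only [assemble, hd, hm, hexp]
  split_ifs with h
  · rw [Finset.mul_sum]
    exact Finset.sum_congr rfl fun j _ => by ring
  · rw [Finset.mul_sum]
    exact Finset.sum_congr rfl fun j _ => by ring

theorem rowSum_false (k N : ℕ) : rowSum k N (fun _ => false) = 0 := by simp [rowSum]

theorem rowSum_true (k N : ℕ) : rowSum k N (fun _ => true) + k = k * 2 ^ N := by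
  unfold rowSum
  rw [← sum_two_pow_rev N]
  simp only [Bool.toNat_true, Finset.sum_const, Finset.card_univ, Fintype.card_fin, smul_eq_mul,
    mul_one, ← Finset.sum_mul]
  ring

/-! ### The top gate: consequences of fooling and the threshold dichotomy. -/

theorem IsThr.exists_thr {ι : Type} {W d : ℕ} (hW : 1 ≤ W) {g : (ι → Bool) → Bool}
    (hg : IsThr W (d + 1) g) : ∃ (κ : Type) (_ : Fintype κ) (t : ℤ) (f : κ → (ι → Bool) → Bool),
      Fintype.card κ ≤ W ∧ (∀ i, IsThr W d (f i)) ∧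
        g = fun x => decide (t ≤ ∑ i, ((f i x).toNat : ℤ)) := by
  rcases hg with hg | hg
  · refine ⟨Unit, inferInstance, 1, fun _ => g, by simpa using hW, fun _ => hg, ?_⟩
    ext x
    cases h : g x <;> simp [h]
  · exact hg

namespace Fools

variable {R I ι : Type} {μ : Expectation R} {κ : R → Expectation I} {W d : ℕ} {ε : ℝ}
  {P Q : I → ι → Bool}

/-- For each public sample, `g` is rarely 1 on `P`, or nearly always 1 on `Q`, or the sample is
exceptional. The first and last cases cost `ε` each. -/
theorem expectation_le (h : Fools μ κ W d ε P Q) (hε₀ : 0 ≤ ε)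
    {g : (ι → Bool) → Bool} (hg : IsThr W d g) :
    μ.bind κ (fun i => ((g (P i)).toNat : ℝ)) ≤
      2 * ε + 2 * μ.bind κ (fun i => ((g (Q i)).toNat : ℝ)) := by
  have h1 := h g hg
  have hb : ∀ b : Bool, (b.toNat : ℝ) ≤ 1 := fun b => by cases b <;> simp
  have h2 := μ.mono (f := fun ρ => κ ρ (fun i => ((g (P i)).toNat : ℝ)))
    (g := fun ρ => ε + ((if ε < κ ρ (fun i => ((g (P i)).toNat : ℝ)) ∧
      κ ρ (fun i => ((g (Q i)).toNat : ℝ)) < 1 - ε then 1 else 0) +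
      2 * κ ρ (fun i => ((g (Q i)).toNat : ℝ)))) fun ρ => by
    have hQ : 0 ≤ κ ρ (fun i => ((g (Q i)).toNat : ℝ)) := (κ ρ).nonneg fun i => by positivity
    have hP : κ ρ (fun i => ((g (P i)).toNat : ℝ)) ≤ 1 := (κ ρ).le_const fun i => hb _
    split_ifs with hc
    · linarith
    · by_cases h3 : ε < κ ρ (fun i => ((g (P i)).toNat : ℝ))
      · have h4 : ¬ κ ρ (fun i => ((g (Q i)).toNat : ℝ)) < 1 - ε := fun h4 => hc ⟨h3, h4⟩
        linarith
      · linarith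
  rw [μ.add, μ.add, μ.const, μ.const_mul] at h2
  rw [Expectation.bind_apply, Expectation.bind_apply]
  linarith

/-- The dual of `expectation_le`. If `g` is rarely 1 on `P`, it is 0 there with probability at least
`1 - ε ≥ 1 / 2`, whence the factor 2. -/
theorem expectation_compl_le (h : Fools μ κ W d ε P Q) (hε₀ : 0 ≤ ε) (hε : ε ≤ 1 / 2)
    {g : (ι → Bool) → Bool} (hg : IsThr W d g) :
    μ.bind κ (fun i => 1 - ((g (Q i)).toNat : ℝ)) ≤
      2 * ε + 2 * μ.bind κ (fun i => 1 - ((g (P i)).toNat : ℝ)) := by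
  have h1 := h g hg
  have hb : ∀ b : Bool, (b.toNat : ℝ) ≤ 1 := fun b => by cases b <;> simp
  have h2 := μ.mono (f := fun ρ => κ ρ (fun i => 1 - ((g (Q i)).toNat : ℝ)))
    (g := fun ρ => ε + ((if ε < κ ρ (fun i => ((g (P i)).toNat : ℝ)) ∧
      κ ρ (fun i => ((g (Q i)).toNat : ℝ)) < 1 - ε then 1 else 0) +
      2 * κ ρ (fun i => 1 - ((g (P i)).toNat : ℝ)))) fun ρ => by
    have hQ : 0 ≤ κ ρ (fun i => ((g (Q i)).toNat : ℝ)) := (κ ρ).nonneg fun i => by positivity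
    have hP : κ ρ (fun i => ((g (P i)).toNat : ℝ)) ≤ 1 := (κ ρ).le_const fun i => hb _
    rw [(κ ρ).sub, (κ ρ).sub, (κ ρ).const]
    split_ifs with hc
    · linarith
    · by_cases h3 : ε < κ ρ (fun i => ((g (P i)).toNat : ℝ))
      · have h4 : ¬ κ ρ (fun i => ((g (Q i)).toNat : ℝ)) < 1 - ε := fun h4 => hc ⟨h3, h4⟩
        linarith
      · linarith
  rw [μ.add, μ.add, μ.const, μ.const_mul] at h2
  rw [Expectation.bind_apply, Expectation.bind_apply]
  linarith

end Fools

/-- The gates that are not determined by a lower bound `e` and an upper bound `f`. -/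
def undecided {κ : Type} [Fintype κ] (e f : κ → Bool) : Finset κ :=
  Finset.univ.filter fun i => f i = true ∧ e i = false

theorem sum_toNat_eq_add_undecided {κ : Type} [Fintype κ] {e f Z : κ → Bool} (he : e ≤ Z)
    (hf : Z ≤ f) : ∑ i, ((Z i).toNat : ℤ) =
      ∑ i, ((e i).toNat : ℤ) + ∑ i ∈ undecided e f, ((Z i).toNat : ℤ) := by
  unfold undecided
  rw [Finset.sum_filter, ← Finset.sum_add_distrib]
  refine Finset.sum_congr rfl fun i _ => ?_
  have h1 := he i
  have h2 := hf i
  cases h : e i <;> cases h' : f i <;> cases h'' : Z i <;> simp_all <;>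
    exact absurd ‹true ≤ false› (by decide)

/-- If few of the undecided gates get decided, then either the threshold is hardly ever reached
by the values `Y`, or it is nearly always reached by the values `O`. -/
theorem threshold_dichotomy {Ω κ : Type} [Fintype κ] (E : Expectation Ω) {e f : κ → Bool}
    {e' f' Y O : Ω → κ → Bool} {ε : ℝ} (hε : 0 ≤ ε) (t : ℤ)
    (hee' : ∀ ω, e ≤ e' ω) (hff' : ∀ ω, f' ω ≤ f) (heY : ∀ ω, e ≤ Y ω) (hYf : ∀ ω, Y ω ≤ f)
    (heO : ∀ ω, e ≤ O ω) (hOf : ∀ ω, O ω ≤ f)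
    (hY : ∀ i, E (fun ω => ((Y ω i).toNat : ℝ)) ≤ 2 * ε + 4 * E (fun ω => ((e' ω i).toNat : ℝ)))
    (hO : ∀ i, E (fun ω => 1 - ((O ω i).toNat : ℝ)) ≤
      2 * ε + 4 * E (fun ω => 1 - ((f' ω i).toNat : ℝ)))
    (hS : E (fun ω => ((undecided e f).card : ℝ) - (undecided (e' ω) (f' ω)).card) ≤
      ε * (undecided e f).card) :
    E (fun ω => ((decide (t ≤ ∑ i, ((Y ω i).toNat : ℤ))).toNat : ℝ)) ≤ 16 * ε ∨
      1 - 16 * ε ≤ E (fun ω => ((decide (t ≤ ∑ i, ((O ω i).toNat : ℤ))).toNat : ℝ)) := by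
  classical
  set T := undecided e f with hT
  have hYs := fun ω => sum_toNat_eq_add_undecided (heY ω) (hYf ω)
  have hOs := fun ω => sum_toNat_eq_add_undecided (heO ω) (hOf ω)
  rw [← hT] at hYs hOs
  set n := ∑ i, ((e i).toNat : ℤ)
  simp only [hYs, hOs]
  have hsub : ∀ ω, undecided (e' ω) (f' ω) ⊆ T := by
    intro ω i hi
    simp only [hT, undecided, Finset.mem_filter, Finset.mem_univ, true_and] at hi ⊢
    have h1 := hee' ω i
    have h2 := hff' ω i
    rw [hi.1] at h2
    rw [hi.2] at h1
    exact ⟨Bool.eq_true_of_true_le h2, Bool.eq_false_of_le_false h1⟩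
  have hcard : ∀ ω, ((undecided (e' ω) (f' ω)).card : ℝ) =
      ∑ i ∈ T, if i ∈ undecided (e' ω) (f' ω) then (1 : ℝ) else 0 := by
    intro ω
    rw [Finset.sum_ite_mem, Finset.inter_eq_right.2 (hsub ω)]
    simp
  -- A gate of `T` whose lower bound becomes 1 leaves the undecided set, so it is counted in the
  -- drop; in `hf'T` the same happens when the upper bound becomes 0.
  have he'T : ∑ i ∈ T, E (fun ω => ((e' ω i).toNat : ℝ)) ≤ ε * T.card := by
    rw [← E.sum]
    refine le_trans (E.mono fun ω => ?_) hS
    rw [hcard, Finset.card_eq_sum_ones, Nat.cast_sum, ← Finset.sum_sub_distrib]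
    refine Finset.sum_le_sum fun i _ => ?_
    cases h : e' ω i <;> cases h' : f' ω i <;> simp [undecided, h, h']
  have hf'T : ∑ i ∈ T, E (fun ω => 1 - ((f' ω i).toNat : ℝ)) ≤ ε * T.card := by
    rw [← E.sum]
    refine le_trans (E.mono fun ω => ?_) hS
    rw [hcard, Finset.card_eq_sum_ones, Nat.cast_sum, ← Finset.sum_sub_distrib]
    refine Finset.sum_le_sum fun i _ => ?_
    cases h : e' ω i <;> cases h' : f' ω i <;> simp [undecided, h, h']
  have hYT : E (fun ω => ∑ i ∈ T, ((Y ω i).toNat : ℝ)) ≤ 6 * ε * T.card := by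
    rw [E.sum]
    refine (Finset.sum_le_sum fun i _ => hY i).trans ?_
    rw [Finset.sum_add_distrib, Finset.sum_const, nsmul_eq_mul, ← Finset.mul_sum]
    linarith
  have hOT : E (fun ω => ∑ i ∈ T, (1 - ((O ω i).toNat : ℝ))) ≤ 6 * ε * T.card := by
    rw [E.sum]
    refine (Finset.sum_le_sum fun i _ => hO i).trans ?_
    rw [Finset.sum_add_distrib, Finset.sum_const, nsmul_eq_mul, ← Finset.mul_sum]
    linarith
  rcases Finset.eq_empty_or_nonempty T with hemp | hne
  · simp only [hemp, Finset.sum_empty, add_zero]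
    rw [E.const]
    by_cases htn : t ≤ n
    · right
      simp only [htn, decide_true, Bool.toNat_true, Nat.cast_one]
      linarith
    · left
      simp only [htn, decide_false, Bool.toNat_false, Nat.cast_zero]
      linarith
  · have hpos : (0 : ℝ) < T.card := by exact_mod_cast hne.card_pos
    -- The threshold needs more than half of `T`, or at most half. Markov's inequality bounds the
    -- exceptional probability by `12 * ε` either way.
    by_cases hcase : (T.card : ℤ) < 2 * (t - n)
    · left
      have h1 : E (fun ω => ((decide (t ≤ n + ∑ i ∈ T, ((Y ω i).toNat : ℤ))).toNat : ℝ)) ≤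
          E (fun ω => 2 / T.card * ∑ i ∈ T, ((Y ω i).toNat : ℝ)) := by
        refine E.mono fun ω => ?_
        by_cases hd : t ≤ n + ∑ i ∈ T, ((Y ω i).toNat : ℤ)
        · simp only [hd, decide_true, Bool.toNat_true, Nat.cast_one]
          rw [div_mul_eq_mul_div, le_div_iff₀ hpos, one_mul]
          have h2 : (T.card : ℤ) ≤ 2 * ∑ i ∈ T, ((Y ω i).toNat : ℤ) := by linarith
          exact_mod_cast h2
        · simp only [hd, decide_false, Bool.toNat_false, Nat.cast_zero]
          positivity
      rw [E.const_mul] at h1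
      refine h1.trans ((mul_le_mul_of_nonneg_left hYT (by positivity)).trans ?_)
      rw [div_mul_eq_mul_div, div_le_iff₀ hpos]
      nlinarith [mul_nonneg hε hpos.le]
    · right
      have h1 : E (fun ω =>
          1 - ((decide (t ≤ n + ∑ i ∈ T, ((O ω i).toNat : ℤ))).toNat : ℝ)) ≤
          E (fun ω => 2 / T.card * ∑ i ∈ T, (1 - ((O ω i).toNat : ℝ))) := by
        refine E.mono fun ω => ?_
        have hle : ∀ i ∈ T, (0 : ℝ) ≤ 1 - ((O ω i).toNat : ℝ) := fun i _ => by
          cases O ω i <;> simp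
        by_cases hd : t ≤ n + ∑ i ∈ T, ((O ω i).toNat : ℤ)
        · simp only [hd, decide_true, Bool.toNat_true, Nat.cast_one, sub_self]
          exact mul_nonneg (by positivity) (Finset.sum_nonneg hle)
        · simp only [hd, decide_false, Bool.toNat_false, Nat.cast_zero, sub_zero]
          rw [div_mul_eq_mul_div, le_div_iff₀ hpos, one_mul, Finset.sum_sub_distrib,
            Finset.sum_const, nsmul_eq_mul, mul_one]
          have h2 : 2 * ∑ i ∈ T, ((O ω i).toNat : ℤ) ≤ T.card := by linarith
          have h3 : 2 * ∑ i ∈ T, ((O ω i).toNat : ℝ) ≤ T.card := by exact_mod_cast h2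
          linarith
      rw [E.const_mul, E.sub, E.const] at h1
      have h2 := mul_le_mul_of_nonneg_left hOT (show (0 : ℝ) ≤ 2 / T.card by positivity)
      have h3 : 2 / (T.card : ℝ) * (6 * ε * T.card) ≤ 16 * ε := by
        rw [div_mul_eq_mul_div, div_le_iff₀ hpos]
        nlinarith [mul_nonneg hε hpos.le]
      linarith

/-! ### The harmonic potential. -/

/-- The harmonic numbers as real numbers. -/
noncomputable def realHarmonic (n : ℕ) : ℝ := ∑ i ∈ Finset.range n, 1 / ((i : ℝ) + 1)

theorem realHarmonic_mono : Monotone realHarmonic := by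
  refine monotone_nat_of_le_succ fun n => ?_
  unfold realHarmonic
  rw [Finset.sum_range_succ]
  have : (0 : ℝ) ≤ 1 / ((n : ℝ) + 1) := by positivity
  linarith

/-- Each of the `n - m` terms between the two harmonic numbers is at least `1 / n`. Thus a relative
drop is paid for by a drop of the potential, which unlike a logarithm is also finite at 0. -/
theorem sub_le_mul_realHarmonic_sub {m n : ℕ} (h : m ≤ n) :
    (n : ℝ) - m ≤ n * (realHarmonic n - realHarmonic m) := by
  unfold realHarmonic
  rw [← Finset.sum_Ico_eq_sub _ h, Finset.mul_sum]
  have h1 : (n : ℝ) - m = ∑ i ∈ Finset.Ico m n, (1 : ℝ) := by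
    simp [Nat.cast_sub h]
  rw [h1]
  refine Finset.sum_le_sum fun i hi => ?_
  rw [Finset.mem_Ico] at hi
  rw [mul_one_div, le_div_iff₀ (by positivity), one_mul]
  exact_mod_cast hi.2

theorem realHarmonic_two_pow_le (L : ℕ) : realHarmonic (2 ^ L) ≤ L + 1 := by
  induction L with
  | zero => simp [realHarmonic]
  | succ L ih =>
    have h : realHarmonic (2 ^ (L + 1)) - realHarmonic (2 ^ L) ≤ 1 := by
      unfold realHarmonic
      rw [← Finset.sum_Ico_eq_sub _ (Nat.pow_le_pow_right (by norm_num) (Nat.le_succ L))]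
      have h1 : ∀ i ∈ Finset.Ico (2 ^ L : ℕ) (2 ^ (L + 1)), 1 / ((i : ℝ) + 1) ≤ 1 / (2 ^ L : ℝ) := by
        intro i hi
        rw [Finset.mem_Ico] at hi
        have : (2 ^ L : ℝ) ≤ i := by exact_mod_cast hi.1
        gcongr
        linarith
      refine (Finset.sum_le_card_nsmul _ _ _ h1).trans ?_
      rw [Nat.card_Ico, nsmul_eq_mul, pow_succ, show 2 ^ L * 2 - 2 ^ L = 2 ^ L by omega]
      simp
    push_cast
    linarith

/-- Only rarely does a non-increasing natural number drop by a factor `1 - ε` in expectation. -/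
theorem indicator_drop_mul_le {Ω : Type} (E : Expectation Ω) {ε : ℝ} (S : ℕ) (S' : Ω → ℕ)
    (hS : ∀ ω, S' ω ≤ S) :
    (if E (fun ω => (S : ℝ) - S' ω) ≤ ε * S then 0 else 1) * ε ≤
      realHarmonic S - E (fun ω => realHarmonic (S' ω)) := by
  have h0 : E (fun ω => realHarmonic (S' ω)) ≤ realHarmonic S :=
    E.le_const fun ω => realHarmonic_mono (hS ω)
  split_ifs with h
  · linarith
  · have h1 : E (fun ω => (S : ℝ) - S' ω) ≤
        E (fun ω => S * (realHarmonic S - realHarmonic (S' ω))) :=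
      E.mono fun ω => sub_le_mul_realHarmonic_sub (hS ω)
    rw [E.const_mul, E.sub (fun _ => realHarmonic S), E.const] at h1
    have hpos : (0 : ℝ) < S := by
      rcases Nat.eq_zero_or_pos S with h2 | h2
      · exfalso
        apply h
        simpa [h2] using h1
      · exact_mod_cast h2
    rw [one_mul]
    have h2 : ε * S < S * (realHarmonic S - E (fun ω => realHarmonic (S' ω))) :=
      lt_of_lt_of_le (not_le.1 h) h1
    rw [mul_comm] at h2
    exact (lt_of_mul_lt_mul_left h2 hpos.le).le

/-- A position with a large expected relative drop costs at least `ε` of expected potential. These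
costs telescope over the `M` positions to at most the initial potential. -/
theorem uniform_walk_drop_le {Ω : Type} (E : Expectation Ω) (l₀ : ℕ → Ω) {ε : ℝ} (hε : 0 < ε)
    (M : ℕ) [NeZero M] (S : ℕ → (ℕ → Ω) → ℕ)
    (hS : ∀ n l a, S (n + 1) (Function.update l n a) ≤ S n l) :
    Expectation.uniform M (fun a => E.walk l₀ a fun l =>
      if E (fun ω => (S a l : ℝ) - S (a + 1) (Function.update l a ω)) ≤ ε * S a l then 0 else 1) ≤
      realHarmonic (S 0 l₀) / (ε * M) := by
  set h : ℕ → ℝ := fun a => E.walk l₀ a fun l => realHarmonic (S a l) with hh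
  have h1 : ∀ a : ℕ, (E.walk l₀ a fun l =>
      if E (fun ω => (S a l : ℝ) - S (a + 1) (Function.update l a ω)) ≤ ε * S a l
        then 0 else 1) ≤ (h a - h (a + 1)) / ε := by
    intro a
    rw [le_div_iff₀ hε, mul_comm, ← Expectation.const_mul]
    simp only [hh]
    rw [Expectation.walk_succ, ← Expectation.sub]
    refine Expectation.mono _ fun l => ?_
    rw [mul_comm]
    exact indicator_drop_mul_le E (S a l) _ fun ω => hS a l ω
  rw [Expectation.uniform_apply]
  have hM : (0 : ℝ) < M := by exact_mod_cast Nat.pos_of_ne_zero (NeZero.ne M)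
  rw [div_le_div_iff₀ hM (by positivity)]
  have h2 : ∑ a : Fin M, (h a - h (a + 1)) / ε ≤ realHarmonic (S 0 l₀) / ε := by
    rw [← Finset.sum_div, Fin.sum_univ_eq_sum_range (fun a => h a - h (a + 1)) M,
      Finset.sum_range_sub']
    have h3 : 0 ≤ h M := Expectation.nonneg _ fun l => by
      have := realHarmonic_mono (Nat.zero_le (S M l))
      simpa [realHarmonic] using this
    have h4 : h 0 = realHarmonic (S 0 l₀) := rfl
    gcongr
    linarith
  have h5 := (Finset.sum_le_sum fun (a : Fin M) _ => h1 a).trans h2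
  rw [le_div_iff₀ hε] at h5
  nlinarith [mul_le_mul_of_nonneg_right h5 hM.le]

/-! ### The induction step: one more level of gates. -/

/-- The position `a` and the blocks before it are public, the block at `a` is private. The
hypothesis on `M` makes positions with a large drop have probability at most `16 * ε`. -/
theorem HasGadget.hardPair {W d N M : ℕ} [NeZero M] {ε : ℝ} (h : HasGadget W ε d N 1)
    (hW : 1 ≤ W) (hε₀ : 0 < ε) (hε : ε ≤ 1 / 2) (hM : realHarmonic W ≤ 16 * ε * (ε * M)) :
    HasHardPair W (16 * ε) (d + 1) (M * N) := by
  obtain ⟨R, I, μ, κ, P₁, Q₁, P₂, Q₂, hP₁, hQ₁, hP₂, hQ₂, hF₁, hF₂⟩ := h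
  obtain ⟨E, hE⟩ : ∃ E : Expectation (I × Bool), ∀ F : I × Bool → ℝ,
      E F = μ.bind κ (fun i => (F (i, true) + F (i, false)) / 2) :=
    ⟨(μ.bind κ).bind fun i => Expectation.coin (i, true) (i, false), fun F => rfl⟩
  -- A single block distribution serves both comparisons: it is `Q₁` half of the time, to be
  -- compared with `P₁`, and `P₂` half of the time, to be compared with `Q₂`. This doubles the
  -- factor 2 to 4 in `hYe` and `hOe`.
  let X : I × Bool → Fin (d + 1) × Fin N → Bool := fun ω => if ω.2 then Q₁ ω.1 else P₂ ω.1
  have hX : ∀ ω, rowSum (d + 1) N (X ω) + 1 = 2 ^ N := by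
    rintro ⟨i, b⟩
    cases b
    · exact hP₂ i
    · exact hQ₁ i
  have hb : ∀ b : Bool, (b.toNat : ℝ) ≤ 1 := fun b => by cases b <;> simp
  have hYe : ∀ g, IsThr W d g → E (fun ω => ((g (P₁ ω.1)).toNat : ℝ)) ≤
      2 * ε + 4 * E (fun ω => ((g (X ω)).toNat : ℝ)) := by
    intro g hg
    have h1 := hF₁.expectation_le hε₀.le hg
    rw [hE, hE]
    have h2 : (μ.bind κ) (fun i => (1 / 2 : ℝ) * ((g (Q₁ i)).toNat : ℝ)) ≤
        (μ.bind κ) (fun i => (((g (X (i, true))).toNat : ℝ) + (g (X (i, false))).toNat) / 2) := by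
      refine Expectation.mono _ fun i => ?_
      have : (0 : ℝ) ≤ (g (X (i, false))).toNat := by positivity
      change _ ≤ (((g (Q₁ i)).toNat : ℝ) + (g (X (i, false))).toNat) / 2
      linarith
    rw [Expectation.const_mul] at h2
    simp only [add_self_div_two]
    linarith
  have hOe : ∀ g, IsThr W d g → E (fun ω => 1 - ((g (Q₂ ω.1)).toNat : ℝ)) ≤
      2 * ε + 4 * E (fun ω => 1 - ((g (X ω)).toNat : ℝ)) := by
    intro g hg
    have h1 := hF₂.expectation_compl_le hε₀.le hε hg
    rw [hE, hE]
    have h2 : (μ.bind κ) (fun i => (1 / 2 : ℝ) * (1 - ((g (P₂ i)).toNat : ℝ))) ≤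
        (μ.bind κ) (fun i =>
          (1 - ((g (X (i, true))).toNat : ℝ) + (1 - ((g (X (i, false))).toNat : ℝ))) / 2) := by
      refine Expectation.mono _ fun i => ?_
      have := hb (g (X (i, true)))
      change _ ≤ (1 - ((g (X (i, true))).toNat : ℝ) + (1 - ((g (P₂ i)).toNat : ℝ))) / 2
      linarith
    rw [Expectation.const_mul] at h2
    simp only [add_self_div_two]
    linarith
  obtain ⟨ω₀⟩ := E.nonempty
  refine ⟨Fin M × (ℕ → I × Bool), Fin M × (ℕ → I × Bool) × I × Bool,
    (Expectation.uniform M).bind fun a =>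
      (E.walk (fun _ => ω₀) a).map fun l => (a, l),
    fun ρ => E.map fun ω => (ρ.1, ρ.2, ω),
    fun i => assemble M (i.1 + 1) (Function.update (X ∘ i.2.1) i.1 (P₁ i.2.2.1)) false,
    fun i => assemble M (i.1 + 1) (Function.update (X ∘ i.2.1) i.1 (Q₂ i.2.2.1)) true,
    ?_, ?_, ?_⟩
  · rintro ⟨a, l, ω⟩
    rw [rowSum_assemble, mul_comm M N, pow_mul]
    refine hornerSum_eq_pow (a := a.val) (fun b hb => ?_) ?_ (fun b hb => ?_) a.isLt
    · rw [if_pos (by simpa using hb.le), Function.update_of_ne hb.ne]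
      exact hX _
    · simp [hP₁]
    · rw [if_neg (by simpa using hb), rowSum_false]
  · rintro ⟨a, l, ω⟩
    rw [rowSum_assemble, mul_comm M N, pow_mul]
    refine hornerSum_add_eq_pow (a := a.val) (fun b hb => ?_) ?_ (fun b hb => ?_) a.isLt
    · rw [if_pos (by simpa using hb.le), Function.update_of_ne hb.ne]
      exact hX _
    · simp [hQ₂]
    · rw [if_neg (by simpa using hb), rowSum_true]
  · intro g hg
    obtain ⟨γ, _, t, f, hγ, hf, rfl⟩ := hg.exists_thr hW
    -- By monotonicity, filling the unrevealed blocks with zeros or ones gives the extreme values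
    -- `e` and `u` of each subformula given the first `n` blocks.
    let e : ℕ → (ℕ → I × Bool) → γ → Bool := fun n l i => f i (assemble M n (X ∘ l) false)
    let u : ℕ → (ℕ → I × Bool) → γ → Bool := fun n l i => f i (assemble M n (X ∘ l) true)
    let S : ℕ → (ℕ → I × Bool) → ℕ := fun n l => (undecided (e n l) (u n l)).card
    have hupd : ∀ n (l : ℕ → I × Bool) (x : Fin (d + 1) × Fin N → Bool) (z : Bool),
        assemble M n (X ∘ l) z = assemble M n (Function.update (X ∘ l) n x) z := fun n l x z =>
      assemble_congr fun b hb => (Function.update_of_ne hb.ne _ _).symm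
    have hlow : ∀ n l x z i,
        e n l i ≤ f i (assemble M (n + 1) (Function.update (X ∘ l) n x) z) := by
      intro n l x z i
      simp only [e]
      rw [hupd n l x]
      exact (hf i).monotone (assemble_false_le (Nat.le_succ n) _ _)
    have hupp : ∀ n l x z i,
        f i (assemble M (n + 1) (Function.update (X ∘ l) n x) z) ≤ u n l i := by
      intro n l x z i
      simp only [u]
      rw [hupd n l x]
      exact (hf i).monotone (le_assemble_true (Nat.le_succ n) _ _)
    have hS : ∀ n l a, S (n + 1) (Function.update l n a) ≤ S n l := by
      intro n l a
      refine Finset.card_le_card fun i hi => ?_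
      simp only [undecided, Finset.mem_filter, Finset.mem_univ, true_and, e, u,
        Function.comp_update] at hi ⊢
      have h1 := hlow n l (X a) false i
      have h2 := hupp n l (X a) true i
      rw [hi.1] at h2
      rw [hi.2] at h1
      exact ⟨Bool.eq_true_of_true_le h2, Bool.eq_false_of_le_false h1⟩
    have hcard : S 0 (fun _ => ω₀) ≤ W := (Finset.card_le_univ _).trans hγ
    have hYf : ∀ a l i, E (fun ω =>
        ((f i (assemble M (a + 1) (Function.update (X ∘ l) a (P₁ ω.1)) false)).toNat : ℝ)) ≤
        2 * ε + 4 * E (fun ω => ((e (a + 1) (Function.update l a ω) i).toNat : ℝ)) := by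
      intro a l i
      simp only [e, Function.comp_update]
      exact hYe (fun x => f i (assemble M (a + 1) (Function.update (X ∘ l) a x) false))
        ((hf i).comp_subst (isSubst_assemble_update M a (X ∘ l) false))
    have hOf : ∀ a l i, E (fun ω =>
        1 - ((f i (assemble M (a + 1) (Function.update (X ∘ l) a (Q₂ ω.1)) true)).toNat : ℝ)) ≤
        2 * ε + 4 * E (fun ω => 1 - ((u (a + 1) (Function.update l a ω) i).toNat : ℝ)) := by
      intro a l i
      simp only [u, Function.comp_update]
      exact hOe (fun x => f i (assemble M (a + 1) (Function.update (X ∘ l) a x) true))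
        ((hf i).comp_subst (isSubst_assemble_update M a (X ∘ l) true))
    have key := uniform_walk_drop_le E (fun _ => ω₀) hε₀ M S hS
    have hMpos : (0 : ℝ) < M := by exact_mod_cast Nat.pos_of_ne_zero (NeZero.ne M)
    have hbound : realHarmonic (S 0 (fun _ => ω₀)) / (ε * M) ≤ 16 * ε := by
      rw [div_le_iff₀ (by positivity)]
      exact (realHarmonic_mono hcard).trans hM
    refine le_trans ?_ (key.trans hbound)
    rw [Expectation.bind_apply]
    refine Expectation.mono _ fun a => ?_
    rw [Expectation.map_apply]
    refine Expectation.mono _ fun l => ?_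
    simp only [Expectation.map_apply]
    by_cases hdrop : E (fun ω => (S a l : ℝ) - S (a + 1) (Function.update l a ω)) ≤ ε * S a l
    · rw [if_pos hdrop]
      refine le_of_eq (if_neg ?_)
      rintro ⟨hy, ho⟩
      rcases threshold_dichotomy E (e := e a l) (f := u a l)
        (e' := fun ω => e (a + 1) (Function.update l a ω))
        (f' := fun ω => u (a + 1) (Function.update l a ω))
        (Y := fun ω i =>
          f i (assemble M (a + 1) (Function.update (X ∘ l) a (P₁ ω.1)) false))
        (O := fun ω i =>
          f i (assemble M (a + 1) (Function.update (X ∘ l) a (Q₂ ω.1)) true))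
        hε₀.le t
        (fun ω i => by
          simp only [e, Function.comp_update]
          exact hlow a l (X ω) false i)
        (fun ω i => by
          simp only [u, Function.comp_update]
          exact hupp a l (X ω) true i)
        (fun ω i => hlow a l _ _ i) (fun ω i => hupp a l _ _ i)
        (fun ω i => hlow a l _ _ i) (fun ω i => hupp a l _ _ i)
        (fun i => hYf a l i) (fun i => hOf a l i)
        hdrop with h1 | h1
      · exact absurd h1 (not_le.2 hy)
      · exact absurd h1 (not_le.2 ho)
    · rw [if_neg hdrop]
      split_ifs <;> norm_num

/-! ### The base case: depth one and two rows. -/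

/-- Few entries of a sequence of natural numbers exceed the sum of all later entries. -/
theorem two_pow_card_dominant_le {n : ℕ} (p : Fin n → ℕ) :
    2 ^ (Finset.univ.filter fun j => ∑ c, (if j < c then p c else 0) < p j).card ≤
      ∑ c, p c + 1 := by
  induction n with
  | zero => simp
  | succ n ih =>
    have h := ih fun c => p c.succ
    -- A first entry exceeding the sum of the others at least doubles the quantity `∑ c, p c + 1`.
    rw [Fin.card_filter_univ_succ, Fin.sum_univ_succ]
    simp only [Fin.sum_univ_succ, Fin.succ_pos, if_true, lt_irrefl, if_false,
      Fin.succ_lt_succ_iff, Fin.not_lt_zero, zero_add]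
    split_ifs with h0
    · rw [pow_succ]
      omega
    · omega

theorem sum_later_two_pow {n : ℕ} (j : Fin n) :
    ∑ c : Fin n, 2 ^ (n - (c.val + 1)) * (decide (j < c)).toNat + 1 = 2 ^ (n - (j.val + 1)) := by
  induction n with
  | zero => exact j.elim0
  | succ n ih =>
    rw [Fin.sum_univ_succ]
    have hs : ∀ c : Fin n, n + 1 - (c.succ.val + 1) = n - (c.val + 1) := fun c => by
      rw [Fin.val_succ]
      omega
    simp only [hs]
    induction j using Fin.cases with
    | zero =>
      have := sum_two_pow_rev n
      simpa using this
    | succ j =>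
      simp only [Fin.not_lt_zero, decide_false, Bool.toNat_false, mul_zero, zero_add,
        Fin.succ_lt_succ_iff, hs]
      exact ih j

/-- The input with the rows `y` and `z`. -/
def twoRows {n : ℕ} (y z : Fin n → Bool) : Fin 2 × Fin n → Bool :=
  fun p => if p.1 = 0 then y p.2 else z p.2

theorem rowSum_twoRows {n : ℕ} (y z : Fin n → Bool) :
    rowSum 2 n (twoRows y z) = ∑ c : Fin n, 2 ^ (n - (c.val + 1)) * (y c).toNat +
      ∑ c : Fin n, 2 ^ (n - (c.val + 1)) * (z c).toNat := by
  unfold rowSum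
  rw [← Finset.sum_add_distrib]
  refine Finset.sum_congr rfl fun c _ => ?_
  rw [Fin.sum_univ_two, mul_add]
  simp [twoRows]

/-- A small threshold gate rarely tells the `j`-th unit vector from the sum of the later ones. -/
theorem fools_twoRows {W L n : ℕ} [NeZero n] {ε : ℝ} (hW : 1 ≤ W) (hWL : W < 2 ^ L) (hε : 0 ≤ ε)
    (hL : L ≤ ε * n) (z : Fin n → Fin n → Bool) :
    Fools (Expectation.uniform n) Expectation.dirac W 1 ε
      (fun j => twoRows (fun c => decide (c = j)) (z j))
      (fun j => twoRows (fun c => decide (j < c)) (z j)) := by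
  intro g hg
  obtain ⟨κ, _, t, f, hκ, hf, rfl⟩ := hg.exists_thr hW
  -- Here `o` is the column read in the first row, or `none` for a constant or a second-row
  -- variable, on which both inputs agree.
  have hloc : ∀ i, ∃ o : Option (Fin n), ∀ j,
      (f i (twoRows (fun c => decide (c = j)) (z j))).toNat +
        ∑ c, (if j < c then (if o = some c then 1 else 0) else 0) ≤
      (f i (twoRows (fun c => decide (j < c)) (z j))).toNat + if o = some j then 1 else 0 := by
    intro i
    rcases hf i with ⟨b, hb⟩ | ⟨⟨r, c₀⟩, hv⟩
    · exact ⟨none, fun j => by simp [hb]⟩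
    · by_cases hr : r = 0
      · refine ⟨some c₀, fun j => ?_⟩
        have hsum : ∑ c, (if j < c then (if some c₀ = some c then 1 else 0) else 0) =
            if j < c₀ then 1 else 0 := by
          rw [Finset.sum_eq_single c₀]
          · simp
          · intro c _ hc
            simp [hc.symm]
          · simp
        rw [hsum]
        by_cases h1 : c₀ = j
        · simp [hv, twoRows, hr, h1]
        · by_cases h2 : j < c₀ <;> simp [hv, twoRows, hr, h1, h2]
      · exact ⟨none, fun j => by simp [hv, twoRows, hr]⟩
  choose o ho using hloc
  -- With `p c` wires reading column `c`, replacing the unit vector at `j` by all later ones loses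
  -- `p j` and gains the sum of the later `p c`. The gate can only notice if `j` is dominant.
  let p : Fin n → ℕ := fun c => ∑ i, if o i = some c then 1 else 0
  have hp : ∑ c, p c ≤ W := by
    simp only [p]
    rw [Finset.sum_comm]
    refine le_trans ?_ hκ
    rw [← Finset.card_univ, Finset.card_eq_sum_ones]
    refine Finset.sum_le_sum fun i _ => ?_
    cases h : o i <;> simp
  set B := Finset.univ.filter fun j => ∑ c, (if j < c then p c else 0) < p j with hB
  have hcard : B.card ≤ L := by
    have h1 : 2 ^ B.card ≤ ∑ c, p c + 1 := two_pow_card_dominant_le p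
    have h2 : 2 ^ B.card ≤ 2 ^ L := by omega
    exact (Nat.pow_le_pow_iff_right (by norm_num)).1 h2
  have hn : (0 : ℝ) < n := by exact_mod_cast Nat.pos_of_ne_zero (NeZero.ne n)
  rw [Expectation.uniform_apply, div_le_iff₀ hn]
  refine le_trans ?_ ((Nat.cast_le.2 hcard).trans hL)
  rw [hB, Finset.card_filter, Nat.cast_sum]
  refine Finset.sum_le_sum fun j _ => ?_
  change (if ε < ((decide _).toNat : ℝ) ∧ ((decide _).toNat : ℝ) < 1 - ε then (1 : ℝ) else 0) ≤ _
  split_ifs with h1 h2 h2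
  · simp
  · exfalso
    apply h2
    have hP : t ≤ ∑ i, ((f i (twoRows (fun c => decide (c = j)) (z j))).toNat : ℤ) := by
      by_contra hc
      rw [decide_eq_false hc] at h1
      simp only [Bool.toNat_false, Nat.cast_zero] at h1
      linarith
    have hQ : ¬ t ≤ ∑ i, ((f i (twoRows (fun c => decide (j < c)) (z j))).toNat : ℤ) := by
      intro hc
      have h4 := h1.2
      rw [decide_eq_true hc] at h4
      simp only [Bool.toNat_true, Nat.cast_one] at h4
      linarith
    have h3 := Finset.sum_le_sum fun i (_ : i ∈ Finset.univ) => ho i j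
    rw [Finset.sum_add_distrib, Finset.sum_add_distrib, Finset.sum_comm] at h3
    have h5 : ∑ c, (if j < c then p c else 0) =
        ∑ c, ∑ i, (if j < c then (if o i = some c then 1 else 0) else 0) := by
      refine Finset.sum_congr rfl fun c _ => ?_
      split_ifs
      · rfl
      · simp
    rw [← h5] at h3
    push_cast [← Nat.cast_sum] at hP hQ
    change _ ≤ _ + p j at h3
    have hlt := lt_of_lt_of_le (not_le.1 hQ) hP
    have hlt' : ∑ i, (f i (twoRows (fun c => decide (j < c)) (z j))).toNat <
        ∑ i, (f i (twoRows (fun c => decide (c = j)) (z j))).toNat := by exact_mod_cast hlt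
    omega
  · simp
  · simp

/-- The first row is `2 ^ (n - (j + 1))` or one less. A second row complementary to the smaller
value gives sums `2 ^ n` and `2 ^ n - 1`; one complementary to the larger gives `2 ^ n - 1` and `2 ^
n - 2`. -/
theorem hasGadget_one {W L n : ℕ} [NeZero n] {ε : ℝ} (hW : 1 ≤ W) (hWL : W < 2 ^ L) (hε : 0 ≤ ε)
    (hL : L ≤ ε * n) : HasGadget W ε 1 n 1 := by
  have hunit : ∀ j : Fin n,
      ∑ c : Fin n, 2 ^ (n - (c.val + 1)) * (decide (c = j)).toNat = 2 ^ (n - (j.val + 1)) := by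
    intro j
    rw [Finset.sum_eq_single j] <;> simp +contextual
  have hcompl : ∀ q : Fin n → Bool,
      ∑ c : Fin n, 2 ^ (n - (c.val + 1)) * (q c).toNat +
        ∑ c : Fin n, 2 ^ (n - (c.val + 1)) * (!q c).toNat + 1 = 2 ^ n := by
    intro q
    rw [← Finset.sum_add_distrib, ← sum_two_pow_rev n]
    congr 1
    refine Finset.sum_congr rfl fun c _ => ?_
    cases q c <;> simp
  refine ⟨Fin n, Fin n, Expectation.uniform n, Expectation.dirac,
    fun j => twoRows (fun c => decide (c = j)) (fun c => !decide (j < c)),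
    fun j => twoRows (fun c => decide (j < c)) (fun c => !decide (j < c)),
    fun j => twoRows (fun c => decide (c = j)) (fun c => !decide (c = j)),
    fun j => twoRows (fun c => decide (j < c)) (fun c => !decide (c = j)),
    fun j => ?_, fun j => ?_, fun j => ?_, fun j => ?_,
    fools_twoRows hW hWL hε hL _, fools_twoRows hW hWL hε hL _⟩
  all_goals
    have h1 := sum_later_two_pow j
    have h2 := hunit j
    have h3 := hcompl fun c => decide (j < c)
    have h4 := hcompl fun c => decide (c = j)
    rw [rowSum_twoRows]
    omega

/-! ### Iteration and choice of parameters. -/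

theorem exists_hasGadget {W L M : ℕ} {ε : ℝ} (hW : 1 ≤ W) (hWL : W < 2 ^ L) (hε : 0 < ε)
    (hM : 2 ≤ M) (hL : L ≤ ε * M) (hL' : (L + 1 : ℝ) ≤ 16 * ε * (ε * M)) (k : ℕ)
    (hk : 16 ^ k * ε ≤ 1 / 2) :
    ∃ N, k + 1 ≤ N ∧ N ≤ (2 * M) ^ (k + 1) ∧ HasGadget W (16 ^ k * ε) (k + 1) N 1 := by
  have : NeZero M := ⟨by omega⟩
  induction k with
  | zero =>
    refine ⟨M, by omega, by rw [zero_add, pow_one]; omega, ?_⟩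
    rw [pow_zero, one_mul]
    exact hasGadget_one hW hWL hε.le hL
  | succ k ih =>
    have hmono : ε ≤ 16 ^ k * ε := le_mul_of_one_le_left hε.le (one_le_pow₀ (by norm_num))
    rw [pow_succ'] at hk
    obtain ⟨N, hN, hN', hG⟩ := ih (by linarith)
    have hH : realHarmonic W ≤ 16 * (16 ^ k * ε) * (16 ^ k * ε * M) := by
      refine (realHarmonic_mono hWL.le).trans ((realHarmonic_two_pow_le L).trans (hL'.trans ?_))
      gcongr
    have hG' := (hG.hardPair hW (by positivity) (by linarith) hH).gadget.append_iterate le_rfl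
    rw [← mul_assoc, ← pow_succ'] at hG'
    have hMN : 2 * N ≤ M * N := Nat.mul_le_mul_right N hM
    refine ⟨_, by omega, ?_, hG'⟩
    -- The invariant `k + 1 ≤ N` absorbs the `k + 2` extra columns into a factor 2.
    calc M * N + 1 + (k + 1) ≤ 2 * M * N := by
          rw [mul_assoc]
          omega
      _ ≤ 2 * M * (2 * M) ^ (k + 1) := Nat.mul_le_mul_left _ hN'
      _ = (2 * M) ^ (k + 1 + 1) := (pow_succ' _ _).symm

theorem exists_hasHardPair {W L M : ℕ} {ε : ℝ} (hW : 1 ≤ W) (hWL : W < 2 ^ L) (hε : 0 < ε)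
    (hM : 2 ≤ M) (hL : L ≤ ε * M) (hL' : (L + 1 : ℝ) ≤ 16 * ε * (ε * M)) (k : ℕ)
    (hk : 16 ^ k * ε ≤ 1 / 2) :
    ∃ N, N ≤ (2 * M) ^ (k + 2) ∧ HasHardPair W (16 ^ (k + 1) * ε) (k + 2) N := by
  have : NeZero M := ⟨by omega⟩
  have hmono : ε ≤ 16 ^ k * ε := le_mul_of_one_le_left hε.le (one_le_pow₀ (by norm_num))
  obtain ⟨N, hN, hN', hG⟩ := exists_hasGadget hW hWL hε hM hL hL' k hk
  have hH : realHarmonic W ≤ 16 * (16 ^ k * ε) * (16 ^ k * ε * M) := by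
    refine (realHarmonic_mono hWL.le).trans ((realHarmonic_two_pow_le L).trans (hL'.trans ?_))
    gcongr
  have hP := hG.hardPair hW (by positivity) hk hH
  rw [← mul_assoc, ← pow_succ'] at hP
  refine ⟨_, ?_, hP⟩
  rw [pow_succ' (2 * M) (k + 1)]
  exact Nat.mul_le_mul (by omega) hN'

theorem HasHardPair.not_isThr {W d N : ℕ} {ε : ℝ} (h : HasHardPair W ε d N) (hd : 0 < d)
    (hε : ε < 1) : ¬ IsThr W d (U d N) := by
  intro hU
  obtain ⟨R, I, μ, κ, P, Q, hP, hQ, hF⟩ := h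
  have h1 := hF _ hU
  have hPU : ∀ i, U d N (P i) = true := fun i => by simp [U, hP]
  have hQU : ∀ i, U d N (Q i) = false := fun i => by
    have := hQ i
    simp only [U, decide_eq_false_iff_not]
    omega
  simp only [hPU, hQU, Bool.toNat_true, Bool.toNat_false, Nat.cast_one, Nat.cast_zero,
    Expectation.const, sub_pos, hε, and_self, if_true] at h1
  linarith

/-- A zero least significant column doubles both the sum and the threshold, so the shorter function
is a restriction of the longer one. -/
theorem IsThr.U_of_le {W d k N N' : ℕ} (hN : N ≤ N') (h : IsThr W d (U k N')) :
    IsThr W d (U k N) := by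
  induction N', hN using Nat.le_induction with
  | base => exact h
  | succ N' _ ih =>
    refine ih ?_
    have h1 := h.comp_subst (isSubst_appendColumn (N := N') fun _ => false)
    have h2 : (fun x => U k (N' + 1) (appendColumn (fun _ => false) x)) = U k N' := by
      ext x
      rw [U, U, rowSum_appendColumn, pow_succ']
      simp
    rwa [h2] at h1

theorem block_count_bounds {L A M : ℝ} (hL : 0 ≤ L) (hA : 1 ≤ A) (hM : M = (L + 1) * (A * A)) :
    L ≤ 1 / A * M ∧ L + 1 ≤ 16 * (1 / A) * (1 / A * M) := by
  have hpos : 0 < A := by linarith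
  constructor
  · rw [hM, show 1 / A * ((L + 1) * (A * A)) = (L + 1) * A by field_simp]
    nlinarith
  · rw [hM, show 16 * (1 / A) * (1 / A * ((L + 1) * (A * A))) = 16 * (L + 1) by field_simp]
    linarith

theorem not_isThr_U {W L k N : ℕ} (hW : 1 ≤ W) (hWL : W < 2 ^ L)
    (hN : (2 * ((L + 1) * 2 ^ (8 * (k + 2)))) ^ (k + 2) ≤ N) : ¬ IsThr W (k + 2) (U (k + 2) N) := by
  have hone : (1 : ℝ) ≤ 16 ^ (k + 2) := one_le_pow₀ (by norm_num)
  have hpos : (0 : ℝ) < 16 ^ (k + 2) := by positivity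
  have hM2 : 2 ≤ (L + 1) * 2 ^ (8 * (k + 2)) :=
    Nat.mul_le_mul (Nat.succ_le_succ (Nat.zero_le L))
      (Nat.le_self_pow (by omega) 2)
  -- The initial error is `ε = 1 / 16 ^ (k + 2)`, so `M = (L + 1) / ε ^ 2`; after `k + 1` increases
  -- by the factor 16 the error is `1 / 16`.
  have hM : (((L + 1) * 2 ^ (8 * (k + 2)) : ℕ) : ℝ) = (L + 1) * (16 ^ (k + 2) * 16 ^ (k + 2)) := by
    rw [← mul_pow, pow_mul]
    push_cast
    norm_num
  have h3 : 16 ^ k * (1 / (16 : ℝ) ^ (k + 2)) ≤ 1 / 2 := by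
    rw [mul_one_div, div_le_iff₀ hpos, pow_add]
    have : (0 : ℝ) < 16 ^ k := by positivity
    linarith
  obtain ⟨h1, h2⟩ := block_count_bounds (Nat.cast_nonneg L) hone hM
  obtain ⟨N', hN', hP⟩ := exists_hasHardPair hW hWL (one_div_pos.2 hpos) hM2 h1 h2 k h3
  intro hU
  refine hP.not_isThr (Nat.succ_pos _) ?_ (hU.U_of_le (hN'.trans hN))
  rw [mul_one_div, div_lt_one hpos]
  exact pow_lt_pow_right₀ (by norm_num) (Nat.lt_succ_self _)

theorem two_rpow_le_of_isThr_U {W d n N : ℕ} (hd : 2 ≤ d) (hn : 2 ^ (60 * d) ≤ n)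
    (hN : (2 ^ 13 * n) ^ d ≤ N) (hU : IsThr W d (U d N)) :
    (2 : ℝ) ^ ((n : ℝ) / (2 : ℝ) ^ (60 * d)) ≤ (W : ℝ) := by
  by_contra hlt
  rw [not_le] at hlt
  set q := n / 2 ^ (60 * d)
  have hpow : 0 < 2 ^ (60 * d) := by positivity
  have hq1 : 1 ≤ q := (Nat.one_le_div_iff hpow).2 hn
  have hqn : q * 2 ^ (60 * d) ≤ n := Nat.div_mul_le_self _ _
  have hexp : (n : ℝ) / (2 : ℝ) ^ (60 * d) ≤ ((q + 1 : ℕ) : ℝ) := by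
    rw [div_le_iff₀ (by positivity)]
    have h1 : n < (q + 1) * 2 ^ (60 * d) := Nat.lt_mul_of_div_lt (Nat.lt_succ_self _) hpow
    exact_mod_cast h1.le
  have hWL : W < 2 ^ (q + 1) := by
    have h1 : (W : ℝ) < (2 : ℝ) ^ (((q + 1 : ℕ) : ℝ)) :=
      hlt.trans_le (Real.rpow_le_rpow_of_exponent_le (by norm_num) hexp)
    rw [Real.rpow_natCast] at h1
    exact_mod_cast h1
  -- The maximum covers fan-in bound 0, since `not_isThr_U` needs a positive bound.
  have hWL' : max 1 W < 2 ^ (q + 1) := max_lt (Nat.one_lt_two_pow (by omega)) hWL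
  obtain ⟨k, rfl⟩ : ∃ k, d = k + 2 := ⟨d - 2, by omega⟩
  refine not_isThr_U (le_max_left 1 W) hWL' (le_trans (Nat.pow_le_pow_left ?_ _) hN)
    (hU.mono_fanIn (le_max_right 1 W))
  have h8 : 2 ^ (8 * (k + 2)) ≤ 2 ^ (60 * (k + 2)) := Nat.pow_le_pow_right (by norm_num) (by omega)
  calc 2 * ((q + 1 + 1) * 2 ^ (8 * (k + 2))) ≤ 2 * ((3 * q) * 2 ^ (60 * (k + 2))) := by
        gcongr
        omega
    _ = 6 * (q * 2 ^ (60 * (k + 2))) := by ring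
    _ ≤ 2 ^ 13 * n := Nat.mul_le_mul (by norm_num) hqn

theorem exists_two_rpow_root_le_of_isThr_U {d : ℕ} (hd : 2 ≤ d) :
    ∃ c : ℝ, 0 < c ∧ ∃ N₀ : ℕ, ∀ N : ℕ, N₀ ≤ N → ∀ W, IsThr W d (U d N) →
      (2 : ℝ) ^ (c * (N : ℝ) ^ (1 / (d : ℝ))) ≤ (W : ℝ) := by
  -- Below, `n` is the floor of `y / 2 ^ 13` with `y` the `d`-th root of `N`; rounding loses at most
  -- a factor 2, which turns `2 ^ 13` into `2 ^ 14`.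
  refine ⟨1 / (2 ^ 14 * 2 ^ (60 * d)), by positivity, (2 ^ 13 * (2 ^ (60 * d) + 1)) ^ d,
    fun N hN W hU => ?_⟩
  have hd0 : d ≠ 0 := by omega
  set y : ℝ := (N : ℝ) ^ (1 / (d : ℝ)) with hy
  have hy0 : 0 ≤ y := by positivity
  have hyd : y ^ d = N := by
    rw [hy, one_div]
    exact Real.rpow_inv_natCast_pow (Nat.cast_nonneg N) hd0
  have hybig : (2 ^ 13 * (2 ^ (60 * d) + 1) : ℝ) ≤ y := by
    refine le_of_pow_le_pow_left₀ hd0 hy0 ?_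
    rw [hyd]
    exact_mod_cast hN
  set n := ⌊y / 2 ^ 13⌋₊
  have hnle : (n : ℝ) ≤ y / 2 ^ 13 := Nat.floor_le (by positivity)
  have hlt : y / 2 ^ 13 < n + 1 := Nat.lt_floor_add_one _
  have hpow : (1 : ℝ) ≤ 2 ^ (60 * d) := one_le_pow₀ (by norm_num)
  have hn' : 2 ^ (60 * d) ≤ n := by
    refine Nat.le_floor ?_
    push_cast
    rw [le_div_iff₀ (by positivity)]
    linarith
  have hnN : (2 ^ 13 * n) ^ d ≤ N := by
    have h1 : ((2 ^ 13 * n : ℝ)) ^ d ≤ y ^ d := by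
      refine pow_le_pow_left₀ (by positivity) ?_ d
      rw [le_div_iff₀ (by positivity)] at hnle
      linarith
    rw [hyd] at h1
    exact_mod_cast h1
  refine le_trans (Real.rpow_le_rpow_of_exponent_le (by norm_num) ?_)
    (two_rpow_le_of_isThr_U hd hn' hnN hU)
  have hn1 : (1 : ℝ) ≤ n := by
    have h1 : (2 ^ (60 * d) : ℝ) ≤ n := by exact_mod_cast hn'
    linarith
  rw [div_mul_eq_mul_div, one_mul, ← div_div]
  gcongr
  rw [div_lt_iff₀ (by positivity)] at hlt
  rw [div_le_iff₀ (by positivity)]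
  linarith

/-! ### Threshold functions of an arbitrary number of variables. -/

/-- The variables of `U_{d, m / d}` as the first variables among `m`. -/
def gridEmbedding (d m : ℕ) (p : Fin d × Fin (m / d)) : Fin m :=
  Fin.castLE (Nat.mul_div_le m d) (finProdFinEquiv p)

theorem gridEmbedding_injective (d m : ℕ) : Function.Injective (gridEmbedding d m) :=
  (Fin.castLE_injective _).comp finProdFinEquiv.injective

theorem isMonotoneWeightedThreshold_U_grid (d m : ℕ) :
    IsMonotoneWeightedThreshold fun x : Fin m → Bool =>
      U d (m / d) fun p => x (gridEmbedding d m p) := by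
  classical
  -- Variables outside the grid get the empty sum, that is, weight 0.
  refine ⟨fun v => ∑ p : Fin d × Fin (m / d),
    if gridEmbedding d m p = v then 2 ^ (m / d - (p.2.val + 1)) else 0, 2 ^ (m / d),
    fun v => Finset.sum_nonneg fun p _ => by positivity, fun x => ?_⟩
  have h : ∑ v, (∑ p : Fin d × Fin (m / d),
      if gridEmbedding d m p = v then (2 : ℤ) ^ (m / d - (p.2.val + 1)) else 0) *
        ((x v).toNat : ℤ) = rowSum d (m / d) fun p => x (gridEmbedding d m p) := by
    simp only [Finset.sum_mul, ite_mul, zero_mul]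
    rw [Finset.sum_comm]
    simp only [Finset.sum_ite_eq, Finset.mem_univ, if_true]
    rw [Fintype.sum_prod_type_right]
    simp [rowSum, Finset.mul_sum]
  rw [h]
  simp only [U, decide_eq_true_eq]
  exact_mod_cast Iff.rfl

theorem IsThr.U_of_grid {W d k m : ℕ}
    (h : IsThr W d fun x : Fin m → Bool => U k (m / k) fun p => x (gridEmbedding k m p)) :
    IsThr W d (U k (m / k)) := by
  classical
  have hσ : IsSubst fun (y : Fin k × Fin (m / k) → Bool) (v : Fin m) =>
      if hv : ∃ p, gridEmbedding k m p = v then y hv.choose else false := by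
    intro v
    by_cases hv : ∃ p, gridEmbedding k m p = v
    · exact Or.inr ⟨hv.choose, fun y => dif_pos hv⟩
    · exact Or.inl ⟨false, fun y => dif_neg hv⟩
  have h1 := h.comp_subst hσ
  have h2 : ∀ (y : Fin k × Fin (m / k) → Bool) (p : Fin k × Fin (m / k)),
      (if hv : ∃ p', gridEmbedding k m p' = gridEmbedding k m p then y hv.choose else false) =
        y p := by
    intro y p
    have hv : ∃ p', gridEmbedding k m p' = gridEmbedding k m p := ⟨p, rfl⟩
    rw [dif_pos hv]
    exact congrArg y (gridEmbedding_injective k m hv.choose_spec)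
  simp only [h2] at h1
  exact h1

theorem div_two_mul_root_le {d m : ℕ} (hd : 1 ≤ d) (hm : d ≤ m) :
    (m : ℝ) ^ (1 / (d : ℝ)) / (2 * d) ≤ ((m / d : ℕ) : ℝ) ^ (1 / (d : ℝ)) := by
  have hd' : (1 : ℝ) ≤ d := by exact_mod_cast hd
  have h1 : (m : ℝ) * (1 / (2 * d)) ≤ ((m / d : ℕ) : ℝ) := by
    rw [mul_one_div, div_le_iff₀ (by positivity)]
    have h2 : 1 ≤ m / d := (Nat.one_le_div_iff (by omega)).2 hm
    have h3 : m < (m / d + 1) * d := Nat.lt_mul_of_div_lt (Nat.lt_succ_self _) (by omega)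
    have h4 : m ≤ m / d * (2 * d) := by nlinarith
    exact_mod_cast h4
  refine le_trans ?_ (Real.rpow_le_rpow (by positivity) h1 (by positivity))
  rw [Real.mul_rpow (by positivity) (by positivity), div_eq_mul_one_div]
  gcongr
  have hle : 1 / (2 * (d : ℝ)) ≤ 1 := by
    rw [div_le_one (by positivity)]
    linarith
  -- A number in `(0, 1]` does not decrease when raised to a power `1 / d ≤ 1`.
  have h2 := Real.rpow_le_rpow_of_exponent_ge (x := 1 / (2 * (d : ℝ))) (by positivity) hle
    (show 1 / (d : ℝ) ≤ 1 by
      rw [div_le_one (by positivity)]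
      exact hd')
  rwa [Real.rpow_one] at h2

theorem theorem1 :
    -- the explicit lower bound
    (∀ d n N : ℕ, 2 ≤ d → 2 ^ (60 * d) ≤ n → (2 ^ 13 * n) ^ d ≤ N →
      ∀ C : MonotoneMajorityCircuit (Fin d × Fin N), C.depth ≤ d → C.Computes (U d N) →
        (2 : ℝ) ^ ((n : ℝ) / (2 : ℝ) ^ (60 * d)) ≤ (C.size : ℝ)) ∧
    -- for each fixed depth, size two to the power of order at least the d-th root of N is needed
    (∀ d : ℕ, 2 ≤ d → ∃ c : ℝ, 0 < c ∧ ∃ N₀ : ℕ, ∀ N : ℕ, N₀ ≤ N →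
      ∀ C : MonotoneMajorityCircuit (Fin d × Fin N), C.depth ≤ d → C.Computes (U d N) →
        (2 : ℝ) ^ (c * (N : ℝ) ^ (1 / (d : ℝ))) ≤ (C.size : ℝ)) ∧
    -- monotone weighted threshold gates cannot be simulated efficiently in constant depth
    (∀ d : ℕ, 2 ≤ d → ∃ c : ℝ, 0 < c ∧ ∃ m₀ : ℕ, ∀ m : ℕ, m₀ ≤ m →
      ∃ f : (Fin m → Bool) → Bool, IsMonotoneWeightedThreshold f ∧
        ∀ C : MonotoneMajorityCircuit (Fin m), C.depth ≤ d → C.Computes f →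
          (2 : ℝ) ^ (c * (m : ℝ) ^ (1 / (d : ℝ))) ≤ (C.size : ℝ)) := by
  have hC : ∀ {ι : Type} {d : ℕ} (C : MonotoneMajorityCircuit ι) (f : (ι → Bool) → Bool),
      C.depth ≤ d → C.Computes f → IsThr C.size d f := by
    intro ι d C f hd hf
    have h := C.isThr_eval hd
    rwa [funext hf] at h
  refine ⟨fun d n N hd hn hN C hdepth hU => two_rpow_le_of_isThr_U hd hn hN (hC C _ hdepth hU),
    fun d hd => ?_, fun d hd => ?_⟩
  · obtain ⟨c, hc, N₀, h⟩ := exists_two_rpow_root_le_of_isThr_U hd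
    exact ⟨c, hc, N₀, fun N hN C hdepth hU => h N hN _ (hC C _ hdepth hU)⟩
  · obtain ⟨c, hc, N₀, h⟩ := exists_two_rpow_root_le_of_isThr_U hd
    refine ⟨c / (2 * d), by positivity, d * (N₀ + 1), fun m hm =>
      ⟨_, isMonotoneWeightedThreshold_U_grid d m, fun C hdepth hf => ?_⟩⟩
    have hN : N₀ + 1 ≤ m / d := (Nat.le_div_iff_mul_le (by omega)).2 (by rwa [mul_comm])
    refine le_trans (Real.rpow_le_rpow_of_exponent_le (by norm_num) ?_)
      (h (m / d) (by omega) _ (hC C _ hdepth hf).U_of_grid)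
    have hroot := div_two_mul_root_le (d := d) (m := m) (by omega)
      ((Nat.le_mul_of_pos_right d (Nat.succ_pos N₀)).trans hm)
    calc c / (2 * d) * (m : ℝ) ^ (1 / (d : ℝ)) = c * ((m : ℝ) ^ (1 / (d : ℝ)) / (2 * d)) := by
          ring
      _ ≤ _ := mul_le_mul_of_nonneg_left hroot hc.le
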